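/- Let $\Bbb K$ be a field and let $X_l$ be one of the Dynkin types $A_l$ ($l\ge 1$), $B_l$, $C_l$, $D_l$ ($l\ge 2$). Put $N=l+1,\,2l+1,\,2l,\,2l$ and $\nu=0,-1,1,-1$ for $X=A,B,C,D$ respectively. Let $q\in\Bbb K$ with $q\neq 0$ and $q^2\neq 1$; for $X=B$ suppose also that a square root $q^{1/2}\in\Bbb K$ of $q$ is chosen. For $X=B,C,D$ and $1\le i\le N$ put $i'=N+1-i$; let $\sigma_i=1,0,-1$ according as $i<\frac{N+1}2$, $i=\frac{N+1}2$, $i>\frac{N+1}2$; let $\epsilon_i=1$ if $i\le\frac{N+1}2$ and $\epsilon_i=-\nu$ otherwise; and let $\bar i=i-\sigma_i\nu/2$. With $E_{rs}$ the $N\times N$ matrix units, let $\check R=\check R_q(X_l)$ be Jimbo's solution of the Yang--Baxter equation on $\Bbb K^N\otimes\Bbb K^N$: $$\check R_q(A_l)=q^{-1}\sum_r E_{rr}\otimes E_{rr}+\sum_{r\ne s}E_{rs}\otimes E_{sr}-(q-q^{-1})\sum_{r>s}E_{rr}\otimes E_{ss},$$ and, for $X=B,C,D$, $$\check R_q(X_l)=\sum_{r\ne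 r'}\bigl(q^{-1}E_{rr}\otimes E_{rr}+q\,E_{rr'}\otimes E_{r'r}\bigr)+\sum_{r=r'}E_{rr}\otimes E_{rr}+\sum_{r\ne s,s'}E_{rs}\otimes E_{sr}+(q-q^{-1})\sum_{r>s}\bigl(-E_{rr}\otimes E_{ss}+\epsilon_r\epsilon_s q^{\bar r-\bar s}E_{rs'}\otimes E_{r's}\bigr).$$ Write $\check R(u_c\otimes u_d)=\sum_{a,b}\check R^{ab}_{cd}\,u_a\otimes u_b$. The FRT bialgebra $\mathfrak A(\check R)$ is the $\Bbb K$-algebra generated by $t_{ij}$ $(1\le i,j\le N)$ with the relations $\sum_{c,d}\check R^{ab}_{cd}\,t_{ci}t_{dj}=\sum_{r,s}\check R^{rs}_{ij}\,t_{ar}t_{bs}$ for all indices $a,b,i,j$, with $\Delta(t_{ij})=\sum_k t_{ik}\otimes t_{kj}$ and $\varepsilon(t_{ij})=\delta_{ij}$. A braiding of a bialgebra $H$ with multiplication $m$ is a functional $\mathcal R^+\in(H\otimes H)^*$ which has a convolution inverse $\mathcal R^-$ and satisfies $\mathcal R^+\,m^*(X)\,\mathcal R^-=(m^{\mathrm{op}})^*(X)$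 for all $X\in H^*$, $(m\otimes\mathrm{id})^*(\mathcal R^+)=\mathcal R^+_{13}\mathcal R^+_{23}$ and $(\mathrm{id}\otimes m)^*(\mathcal R^+)=\mathcal R^+_{13}\mathcal R^+_{12}$. For $\eta\in\Bbb K^\times$ let $\mathcal R^+_\eta$ denote the canonical braiding of $\mathfrak A(\eta\check R)$, regarded as a braiding of $\mathfrak A(\check R)$ through the isomorphism $t_{ij}\mapsto t_{ij}$, that is, the unique braiding of $\mathfrak A(\check R)$ such that $\mathcal R^+_\eta(t_{ij},t_{rs})=\eta\,\check R^{ri}_{js}$ for all indices $i,j,r,s$; let $\mathcal R^-_\eta$ be its inverse, and let $(\mathcal R^-_\eta)_{21}(a,b)=\mathcal R^-_\eta(b,a)$. **Theorem.** Every braiding of $\mathfrak A(\check R_q(X_l))$ is either of the form $\mathcal R^+_\eta$ or of the form $(\mathcal R^-_\eta)_{21}$ for some $\eta\in\Bbb K^\times$. -/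

import Mathlib

open scoped TensorProduct

/-! ### Braidings (coquasitriangular structures) on a bialgebra -/

namespace Braiding

variable {K H : Type*} [Field K] [Ring H] [Bialgebra K H]

/-- `Z₁₂ (a ⊗ b ⊗ c) = Z (a ⊗ b) ε(c)`. -/
noncomputable def leg12 (Z : WithConv (H ⊗[K] H →ₗ[K] K)) :
    WithConv ((H ⊗[K] H) ⊗[K] H →ₗ[K] K) :=
  WithConv.toConv (LinearMap.mul' K K ∘ₗ TensorProduct.map Z.ofConv Coalgebra.counit)

/-- `Z₁₃ (a ⊗ b ⊗ c) = Z (a ⊗ c) ε(b)`. -/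
noncomputable def leg13 (Z : WithConv (H ⊗[K] H →ₗ[K] K)) :
    WithConv ((H ⊗[K] H) ⊗[K] H →ₗ[K] K) :=
  WithConv.toConv
    ((leg12 Z).ofConv ∘ₗ (TensorProduct.rightComm K H H H).toLinearMap)

/-- `Z₂₃ (a ⊗ b ⊗ c) = ε(a) Z (b ⊗ c)`. -/
noncomputable def leg23 (Z : WithConv (H ⊗[K] H →ₗ[K] K)) :
    WithConv ((H ⊗[K] H) ⊗[K] H →ₗ[K] K) :=
  WithConv.toConv (LinearMap.mul' K K ∘ₗ TensorProduct.map Coalgebra.counit Z.ofConv ∘ₗ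
    (TensorProduct.assoc K H H H).toLinearMap)

/-- The opposite form `Z₂₁ (a ⊗ b) = Z (b ⊗ a)`. -/
noncomputable def flip (Z : WithConv (H ⊗[K] H →ₗ[K] K)) :
    WithConv (H ⊗[K] H →ₗ[K] K) :=
  WithConv.toConv (Z.ofConv ∘ₗ (TensorProduct.comm K H H).toLinearMap)

end Braiding

/-- `Rp` is a braiding of the bialgebra `H`, with inverse `Rm`. Products of functionals are
convolution products in the dual algebras of the coalgebras `H ⊗ H` and `H ⊗ H ⊗ H`. -/
structure IsBraiding {K H : Type*} [Field K] [Ring H] [Bialgebra K H]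
    (Rp Rm : WithConv (H ⊗[K] H →ₗ[K] K)) : Prop where
  mul_inv : Rp * Rm = 1
  inv_mul : Rm * Rp = 1
  /-- `R⁺ m^*(X) R⁻ = (m^op)^*(X)` for every functional `X` on `H`. -/
  braided : ∀ X : H →ₗ[K] K,
    Rp * WithConv.toConv (X ∘ₗ LinearMap.mul' K H) * Rm =
      WithConv.toConv (X ∘ₗ LinearMap.mul' K H ∘ₗ (TensorProduct.comm K H H).toLinearMap)
  /-- `(m ⊗ id)^*(R⁺) = R⁺₁₃ R⁺₂₃`. -/
  mul_left :
    WithConv.toConv (Rp.ofConv ∘ₗ TensorProduct.map (LinearMap.mul' K H) LinearMap.id) =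
      Braiding.leg13 Rp * Braiding.leg23 Rp
  /-- `(id ⊗ m)^*(R⁺) = R⁺₁₃ R⁺₁₂`. -/
  mul_right :
    WithConv.toConv (Rp.ofConv ∘ₗ TensorProduct.map LinearMap.id (LinearMap.mul' K H) ∘ₗ
        (TensorProduct.assoc K H H H).toLinearMap) =
      Braiding.leg13 Rp * Braiding.leg12 Rp

/-! ### The FRT bialgebra -/

/-- The defining relations of the FRT bialgebra of the operator `w` on `Kⁿ ⊗ Kⁿ`, where
`w (a, b) (c, d)` is the coefficient of `u_a ⊗ u_b` in `w (u_c ⊗ u_d)`. -/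
inductive FRTRel {K n : Type*} [Field K] [Fintype n] (w : Matrix (n × n) (n × n) K) :
    FreeAlgebra K (n × n) → FreeAlgebra K (n × n) → Prop
  | mk (a b p q : n) : FRTRel w
      (∑ c, ∑ d, w (a, b) (c, d) • (FreeAlgebra.ι K (c, p) * FreeAlgebra.ι K (d, q)))
      (∑ r, ∑ s, w (r, s) (p, q) • (FreeAlgebra.ι K (a, r) * FreeAlgebra.ι K (b, s)))

/-- The FRT bialgebra of `w`: the algebra on generators `t i j` modulo `FRTRel w`. -/
abbrev FRT {K n : Type*} [Field K] [Fintype n] (w : Matrix (n × n) (n × n) K) : Type _ :=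
  RingQuot (FRTRel w)

namespace FRT

variable {K n : Type*} [Field K] [Fintype n] (w : Matrix (n × n) (n × n) K)

/-- The generator `t i j`. -/
noncomputable def t (i j : n) : FRT w :=
  RingQuot.mkAlgHom K (FRTRel w) (FreeAlgebra.ι K (i, j))

theorem t_rel (a b p q : n) :
    ∑ c, ∑ d, w (a, b) (c, d) • (t w c p * t w d q) =
      ∑ r, ∑ s, w (r, s) (p, q) • (t w a r * t w b s) := by
  have h := RingQuot.mkAlgHom_rel K (FRTRel.mk (w := w) a b p q)
  simpa [t] using h

theorem sum_swap {n M : Type*} [Fintype n] [AddCommMonoid M] (f : n → n → n → n → M) :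
    ∑ a, ∑ b, ∑ c, ∑ d, f a b c d = ∑ c, ∑ d, ∑ a, ∑ b, f a b c d := by
  have h := Finset.sum_comm (s := (Finset.univ : Finset (n × n)))
    (t := (Finset.univ : Finset (n × n))) (f := fun x y => f x.1 x.2 y.1 y.2)
  simpa only [Fintype.sum_prod_type] using h

/-- The comultiplication `t i j ↦ ∑ k, t i k ⊗ t k j`. -/
noncomputable def comulHom : FRT w →ₐ[K] FRT w ⊗[K] FRT w :=
  RingQuot.liftAlgHom K
    ⟨FreeAlgebra.lift K (fun x : n × n => ∑ k, t w x.1 k ⊗ₜ[K] t w k x.2), by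
      rintro _ _ ⟨a, b, p, q⟩
      simp only [map_sum, map_smul, map_mul, FreeAlgebra.lift_ι_apply, Finset.sum_mul_sum,
        Algebra.TensorProduct.tmul_mul_tmul]
      have h1 : ∀ k l : n, ∑ c, ∑ d, w (a, b) (c, d) •
          ((t w c k * t w d l) ⊗ₜ[K] (t w k p * t w l q)) =
          ∑ r, ∑ s, w (r, s) (k, l) • ((t w a r * t w b s) ⊗ₜ[K] (t w k p * t w l q)) := by
        intro k l
        have := congrArg (fun x => x ⊗ₜ[K] (t w k p * t w l q)) (t_rel w a b k l)
        simpa [TensorProduct.sum_tmul, TensorProduct.smul_tmul'] using this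
      have h2 : ∀ r s : n, ∑ k, ∑ l, w (r, s) (k, l) •
          ((t w a r * t w b s) ⊗ₜ[K] (t w k p * t w l q)) =
          ∑ k, ∑ l, w (k, l) (p, q) • ((t w a r * t w b s) ⊗ₜ[K] (t w r k * t w s l)) := by
        intro r s
        have := congrArg (fun x => (t w a r * t w b s) ⊗ₜ[K] x) (t_rel w r s p q)
        simpa [TensorProduct.tmul_sum, TensorProduct.tmul_smul] using this
      simp only [Finset.smul_sum]
      rw [sum_swap]
      simp only [h1]
      rw [sum_swap]
      simp only [h2]
      exact sum_swap _⟩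

@[simp] theorem comulHom_t (i j : n) : comulHom w (t w i j) = ∑ k, t w i k ⊗ₜ[K] t w k j := by
  simp [comulHom, t]

variable {w} in
theorem algHom_ext {B : Type*} [Semiring B] [Algebra K B] {f g : FRT w →ₐ[K] B}
    (h : ∀ i j, f (t w i j) = g (t w i j)) : f = g := by
  apply RingQuot.ringQuot_ext'
  apply FreeAlgebra.hom_ext
  funext x
  exact h x.1 x.2

variable [DecidableEq n]

/-- The counit `t i j ↦ δ i j`. -/
noncomputable def counitHom : FRT w →ₐ[K] K :=
  RingQuot.liftAlgHom K
    ⟨FreeAlgebra.lift K (fun x : n × n => if x.1 = x.2 then 1 else 0), by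
      rintro _ _ ⟨a, b, p, q⟩
      simp [FreeAlgebra.lift_ι_apply]⟩

@[simp] theorem counitHom_t (i j : n) : counitHom w (t w i j) = if i = j then 1 else 0 := by
  simp [counitHom, t]

noncomputable instance : Bialgebra K (FRT w) :=
  Bialgebra.ofAlgHom (comulHom w) (counitHom w)
    (algHom_ext fun i j => by
      simp [TensorProduct.sum_tmul, TensorProduct.tmul_sum]
      exact Finset.sum_comm)
    (algHom_ext fun i j => by
      simp only [AlgHom.comp_apply, comulHom_t, map_sum, Algebra.TensorProduct.map_tmul,
        counitHom_t]
      simp [TensorProduct.ite_tmul])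
    (algHom_ext fun i j => by
      simp [TensorProduct.tmul_ite])

end FRT

namespace IsBraiding

open Coalgebra TensorProduct

variable {K H : Type*} [Field K] [Ring H] [Bialgebra K H]
  {Rp Rm : WithConv (H ⊗[K] H →ₗ[K] K)}

theorem apply_mul_left (h : IsBraiding Rp Rm) (a b c : H) {ι : Type*} (r : Coalgebra.Repr K c ι) :
    Rp.ofConv ((a * b) ⊗ₜ[K] c) =
      ∑ i ∈ r.index, Rp.ofConv (a ⊗ₜ[K] r.left i) * Rp.ofConv (b ⊗ₜ[K] r.right i) := by
  have key : ∀ (Z : WithConv (H ⊗[K] H →ₗ[K] K)) (A B : H ⊗[K] H),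
      LinearMap.mul' K K (TensorProduct.map (Braiding.leg13 Z).ofConv (Braiding.leg23 Z).ofConv
        (AlgebraTensorModule.tensorTensorTensorComm K K K K (H ⊗[K] H) (H ⊗[K] H) H H
          (AlgebraTensorModule.tensorTensorTensorComm K K K K H H H H (A ⊗ₜ[K] B) ⊗ₜ[K] comul c))) =
      ∑ i ∈ r.index,
        Z.ofConv (TensorProduct.rid K H (TensorProduct.map .id counit A) ⊗ₜ[K] r.left i) *
        Z.ofConv (TensorProduct.lid K H (TensorProduct.map counit .id B) ⊗ₜ[K] r.right i) := by
    intro Z A B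
    induction A using TensorProduct.induction_on with
    | zero => simp
    | add x y hx hy =>
      simp only [add_tmul, map_add, hx, hy, add_mul, Finset.sum_add_distrib]
    | tmul x y =>
      induction B using TensorProduct.induction_on with
      | zero => simp
      | add x y hx hy =>
        simp only [add_tmul, tmul_add, map_add, hx, hy, mul_add, Finset.sum_add_distrib]
      | tmul u v =>
        rw [← r.eq]
        simp only [tmul_sum, map_sum]
        refine Finset.sum_congr rfl fun i _ => ?_
        simp [Braiding.leg13, Braiding.leg12, Braiding.leg23, ← smul_tmul']
        ring
  have h1 := congrArg (fun f => f.ofConv ((a ⊗ₜ[K] b) ⊗ₜ[K] c)) h.mul_left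
  have h2 := key Rp (comul a) (comul b)
  have ha : TensorProduct.rid K H (TensorProduct.map .id counit (comul a)) = a := by
    have := Coalgebra.lTensor_counit_comul (R := K) a
    rw [LinearMap.lTensor] at this
    simp [this]
  have hb : TensorProduct.lid K H (TensorProduct.map counit .id (comul b)) = b := by
    have := Coalgebra.rTensor_counit_comul (R := K) b
    rw [LinearMap.rTensor] at this
    simp [this]
  rw [ha, hb] at h2
  rw [← h2]
  simpa [LinearMap.convMul_def, TensorProduct.comul_tmul] using h1

theorem apply_mul_right (h : IsBraiding Rp Rm) (a b c : H) {ι : Type*}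
    (r : Coalgebra.Repr K a ι) :
    Rp.ofConv (a ⊗ₜ[K] (b * c)) =
      ∑ i ∈ r.index, Rp.ofConv (r.left i ⊗ₜ[K] c) * Rp.ofConv (r.right i ⊗ₜ[K] b) := by
  have key : ∀ (Z : WithConv (H ⊗[K] H →ₗ[K] K)) (B C : H ⊗[K] H),
      LinearMap.mul' K K (TensorProduct.map (Braiding.leg13 Z).ofConv (Braiding.leg12 Z).ofConv
        (AlgebraTensorModule.tensorTensorTensorComm K K K K (H ⊗[K] H) (H ⊗[K] H) H H
          (AlgebraTensorModule.tensorTensorTensorComm K K K K H H H H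
            (comul a ⊗ₜ[K] B) ⊗ₜ[K] C))) =
      ∑ i ∈ r.index,
        Z.ofConv (r.left i ⊗ₜ[K] TensorProduct.rid K H (TensorProduct.map .id counit C)) *
        Z.ofConv (r.right i ⊗ₜ[K] TensorProduct.lid K H (TensorProduct.map counit .id B)) := by
    intro Z B C
    induction B using TensorProduct.induction_on with
    | zero => simp
    | add x y hx hy =>
      simp only [add_tmul, tmul_add, map_add, hx, hy, mul_add, Finset.sum_add_distrib]
    | tmul x y =>
      induction C using TensorProduct.induction_on with
      | zero => simp
      | add x y hx hy =>
        simp only [tmul_add, map_add, hx, hy, add_mul, Finset.sum_add_distrib]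
      | tmul u v =>
        rw [← r.eq]
        simp only [sum_tmul, map_sum]
        refine Finset.sum_congr rfl fun i _ => ?_
        simp [Braiding.leg13, Braiding.leg12]
        ring
  have h1 := congrArg (fun f => f.ofConv ((a ⊗ₜ[K] b) ⊗ₜ[K] c)) h.mul_right
  have h2 := key Rp (comul b) (comul c)
  have hc : TensorProduct.rid K H (TensorProduct.map .id counit (comul c)) = c := by
    have := Coalgebra.lTensor_counit_comul (R := K) c
    rw [LinearMap.lTensor] at this
    simp [this]
  have hb : TensorProduct.lid K H (TensorProduct.map counit .id (comul b)) = b := by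
    have := Coalgebra.rTensor_counit_comul (R := K) b
    rw [LinearMap.rTensor] at this
    simp [this]
  rw [hc, hb] at h2
  rw [← h2]
  simpa [LinearMap.convMul_def, TensorProduct.comul_tmul] using h1

theorem apply_one_left (h : IsBraiding Rp Rm) (c : H) : Rp.ofConv (1 ⊗ₜ[K] c) = counit c := by
  let f : WithConv (H →ₗ[K] K) := WithConv.toConv (Rp.ofConv ∘ₗ TensorProduct.mk K H H 1)
  let g : WithConv (H →ₗ[K] K) := WithConv.toConv (Rm.ofConv ∘ₗ TensorProduct.mk K H H 1)
  have hff : f * f = f := by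
    ext x
    rw [(ℛ K x).convMul_apply]
    have := h.apply_mul_left 1 1 x (ℛ K x)
    rw [mul_one] at this
    exact this.symm
  have hfg : f * g = 1 := by
    ext x
    have := congrArg (fun z => z.ofConv ((1 : H) ⊗ₜ[K] x)) h.mul_inv
    simp only [LinearMap.convMul_apply, TensorProduct.comul_tmul] at this
    rw [(ℛ K x).convMul_apply]
    rw [← (ℛ K x).eq] at this
    simpa [f, g, tmul_sum, Algebra.TensorProduct.one_def] using this
  have hf : f = 1 := by
    calc f = f * (f * g) := by rw [hfg, mul_one]
      _ = (f * f) * g := (mul_assoc _ _ _).symm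
      _ = 1 := by rw [hff, hfg]
  have := congrArg (fun z => z.ofConv c) hf
  simpa [f] using this

theorem apply_one_right (h : IsBraiding Rp Rm) (c : H) : Rp.ofConv (c ⊗ₜ[K] 1) = counit c := by
  let f : WithConv (H →ₗ[K] K) := WithConv.toConv (Rp.ofConv ∘ₗ (TensorProduct.mk K H H).flip 1)
  let g : WithConv (H →ₗ[K] K) := WithConv.toConv (Rm.ofConv ∘ₗ (TensorProduct.mk K H H).flip 1)
  have hff : f * f = f := by
    ext x
    rw [(ℛ K x).convMul_apply]
    have := h.apply_mul_right x 1 1 (ℛ K x)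
    rw [mul_one] at this
    exact this.symm
  have hfg : f * g = 1 := by
    ext x
    have := congrArg (fun z => z.ofConv (x ⊗ₜ[K] (1 : H))) h.mul_inv
    simp only [LinearMap.convMul_apply, TensorProduct.comul_tmul] at this
    rw [(ℛ K x).convMul_apply]
    rw [← (ℛ K x).eq] at this
    simpa [f, g, sum_tmul, Algebra.TensorProduct.one_def] using this
  have hf : f = 1 := by
    calc f = f * (f * g) := by rw [hfg, mul_one]
      _ = (f * f) * g := (mul_assoc _ _ _).symm
      _ = 1 := by rw [hff, hfg]
  have := congrArg (fun z => z.ofConv c) hf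
  simpa [f] using this

end IsBraiding

theorem FRT.induction {K n : Type*} [Field K] [Fintype n] {w : Matrix (n × n) (n × n) K}
    {P : FRT w → Prop} (one : P 1) (t : ∀ i j, P (FRT.t w i j))
    (add : ∀ a b, P a → P b → P (a + b)) (smul : ∀ (k : K) a, P a → P (k • a))
    (mul : ∀ a b, P a → P b → P (a * b)) (x : FRT w) : P x := by
  obtain ⟨y, rfl⟩ := RingQuot.mkAlgHom_surjective K (FRTRel w) x
  induction y using FreeAlgebra.induction with
  | grade0 k =>
    rw [AlgHom.commutes, Algebra.algebraMap_eq_smul_one]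
    exact smul k 1 one
  | grade1 x => exact t x.1 x.2
  | mul a b ha hb => rw [map_mul]; exact mul _ _ ha hb
  | add a b ha hb => rw [map_add]; exact add _ _ ha hb

/-- A braiding of an FRT bialgebra is determined by its values on pairs of generators. -/
theorem IsBraiding.eq_of_apply_t {K n : Type*} [Field K] [Fintype n] [DecidableEq n]
    {w : Matrix (n × n) (n × n) K} {Rp Rm Sp Sm : WithConv (FRT w ⊗[K] FRT w →ₗ[K] K)}
    (hR : IsBraiding Rp Rm) (hS : IsBraiding Sp Sm)
    (h : ∀ p q r s, Rp.ofConv (FRT.t w p q ⊗ₜ[K] FRT.t w r s) =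
      Sp.ofConv (FRT.t w p q ⊗ₜ[K] FRT.t w r s)) : Rp = Sp ∧ Rm = Sm := by
  have hc : ∀ p q, Coalgebra.comul (R := K) (FRT.t w p q) =
      ∑ k, FRT.t w p k ⊗ₜ[K] FRT.t w k q := fun p q => FRT.comulHom_t w p q
  have h1 : ∀ (c : FRT w) (p q : n),
      Rp.ofConv (FRT.t w p q ⊗ₜ[K] c) = Sp.ofConv (FRT.t w p q ⊗ₜ[K] c) := by
    intro c
    induction c using FRT.induction with
    | one => intro p q; rw [hR.apply_one_right, hS.apply_one_right]
    | t i j => intro p q; exact h p q i j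
    | add a b ha hb =>
      intro p q
      rw [TensorProduct.tmul_add, map_add, map_add, ha, hb]
    | smul k a ha => intro p q; rw [TensorProduct.tmul_smul, map_smul, map_smul, ha]
    | mul a b ha hb =>
      intro p q
      let r : Coalgebra.Repr K (FRT.t w p q) n :=
        ⟨Finset.univ, fun k => FRT.t w p k, fun k => FRT.t w k q, (hc p q).symm⟩
      rw [hR.apply_mul_right _ _ _ r, hS.apply_mul_right _ _ _ r]
      exact Finset.sum_congr rfl fun k _ => by simp only [r, ha, hb]
  have h2 : ∀ a c : FRT w, Rp.ofConv (a ⊗ₜ[K] c) = Sp.ofConv (a ⊗ₜ[K] c) := by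
    intro a
    induction a using FRT.induction with
    | one => intro c; rw [hR.apply_one_left, hS.apply_one_left]
    | t i j => intro c; exact h1 c i j
    | add a b ha hb =>
      intro c
      rw [TensorProduct.add_tmul, map_add, map_add, ha, hb]
    | smul k a ha => intro c; rw [← TensorProduct.smul_tmul', map_smul, map_smul, ha]
    | mul a b ha hb =>
      intro c
      rw [hR.apply_mul_left _ _ _ (Coalgebra.Repr.arbitrary K c),
        hS.apply_mul_left _ _ _ (Coalgebra.Repr.arbitrary K c)]
      exact Finset.sum_congr rfl fun k _ => by rw [ha, hb]
  have h3 : Rp = Sp := by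
    apply WithConv.ext
    exact TensorProduct.ext' h2
  refine ⟨h3, ?_⟩
  subst h3
  calc Rm = Rm * (Rp * Sm) := by rw [hS.mul_inv, mul_one]
    _ = (Rm * Rp) * Sm := (mul_assoc _ _ _).symm
    _ = Sm := by rw [hR.inv_mul, one_mul]

/-- `(Rp, Rm)` is the canonical braiding `R⁺_η` of the FRT bialgebra of `η w`, with its inverse
`R⁻_η`, carried to the FRT bialgebra of `w` by the isomorphism `t i j ↦ t i j`: the braiding
with `R⁺_η (t p q ⊗ t r s)` equal to the coefficient of `u_r ⊗ u_p` in `η w (u_q ⊗ u_s)`. There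
is at most one such pair, by `IsCanonicalBraiding.unique`. -/
structure IsCanonicalBraiding {K n : Type*} [Field K] [Fintype n] [DecidableEq n]
    (w : Matrix (n × n) (n × n) K) (η : K)
    (Rp Rm : WithConv (FRT w ⊗[K] FRT w →ₗ[K] K)) : Prop extends IsBraiding Rp Rm where
  apply_t : ∀ p q r s : n, Rp.ofConv (FRT.t w p q ⊗ₜ[K] FRT.t w r s) = η * w (r, p) (q, s)

theorem IsCanonicalBraiding.unique {K n : Type*} [Field K] [Fintype n] [DecidableEq n]
    {w : Matrix (n × n) (n × n) K} {η : K}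
    {Rp Rm Sp Sm : WithConv (FRT w ⊗[K] FRT w →ₗ[K] K)}
    (hR : IsCanonicalBraiding w η Rp Rm) (hS : IsCanonicalBraiding w η Sp Sm) :
    Rp = Sp ∧ Rm = Sm :=
  hR.toIsBraiding.eq_of_apply_t hS.toIsBraiding fun p q r s => by
    rw [hR.apply_t, hS.apply_t]

/-! ### Jimbo's solutions of the Yang-Baxter equation -/

/-- The classical Dynkin types. -/
inductive ClassicalType
  | A
  | B
  | C
  | D

namespace ClassicalType

/-- The least rank considered for each type. -/
def minRank : ClassicalType → ℕ
  | A => 1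
  | _ => 2

/-- The dimension `N` of the vector representation. -/
def dim : ClassicalType → ℕ → ℕ
  | A, l => l + 1
  | B, l => 2 * l + 1
  | C, l => 2 * l
  | D, l => 2 * l

/-- The sign `ν`. -/
def nu : ClassicalType → ℤ
  | A => 0
  | B => -1
  | C => 1
  | D => -1

end ClassicalType

namespace Jimbo

open scoped Kronecker

/-- The position of an index, counted from `1`; the index `i' = N + 1 - i` is `Fin.rev i`. -/
def pos {N : ℕ} (i : Fin N) : ℤ := (i : ℤ) + 1

/-- `σ i` is `1`, `0` or `-1` according as `i` is below, at or above `(N + 1) / 2`. -/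
def sigma {N : ℕ} (i : Fin N) : ℤ :=
  if 2 * pos i < N + 1 then 1 else if 2 * pos i = N + 1 then 0 else -1

/-- The sign `ε i`. -/
def eps (X : ClassicalType) {N : ℕ} (i : Fin N) : ℤ :=
  if 2 * pos i ≤ N + 1 then 1 else -X.nu

/-- Twice the number `ī = i - σ i * ν / 2`. -/
def twiceBar (X : ClassicalType) {N : ℕ} (i : Fin N) : ℤ := 2 * pos i - sigma i * X.nu

/-- `q ^ (r̄ - s̄)`. The exponent is an integer, except in type `B`, where it may be a
half-integer and `v` is the chosen square root of `q`. -/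
def barPow {K : Type*} [Field K] (X : ClassicalType) (q v : K) {N : ℕ} (r s : Fin N) : K :=
  match X with
  | .B => v ^ (twiceBar .B r - twiceBar .B s)
  | X => q ^ ((twiceBar X r - twiceBar X s) / 2)

/-- The matrix unit `E r s`. -/
def E (K : Type*) [Field K] {N : ℕ} (r s : Fin N) : Matrix (Fin N) (Fin N) K :=
  Matrix.single r s 1

/-- The solution in type `A`, on `K ^ N ⊗ K ^ N`. -/
def matA {K : Type*} [Field K] (N : ℕ) (q : K) : Matrix (Fin N × Fin N) (Fin N × Fin N) K :=
  q⁻¹ • (∑ r, E K r r ⊗ₖ E K r r)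
    + (∑ r, ∑ s, if r ≠ s then E K r s ⊗ₖ E K s r else 0)
    - (q - q⁻¹) • (∑ r, ∑ s, if s < r then E K r r ⊗ₖ E K s s else 0)

/-- The solution in types `B`, `C` and `D`, on `K ^ N ⊗ K ^ N`. -/
def matBCD {K : Type*} [Field K] (X : ClassicalType) (N : ℕ) (q v : K) :
    Matrix (Fin N × Fin N) (Fin N × Fin N) K :=
  (∑ r, if r ≠ r.rev then
      q⁻¹ • (E K r r ⊗ₖ E K r r) + q • (E K r r.rev ⊗ₖ E K r.rev r) else 0)
    + (∑ r, if r = r.rev then E K r r ⊗ₖ E K r r else 0)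
    + (∑ r, ∑ s, if r ≠ s ∧ r ≠ s.rev then E K r s ⊗ₖ E K s r else 0)
    + (q - q⁻¹) • (∑ r, ∑ s, if s < r then
        -(E K r r ⊗ₖ E K s s)
          + (((eps X r * eps X s : ℤ) : K) * barPow X q v r s) •
            (E K r s.rev ⊗ₖ E K r.rev s)
        else 0)

/-- Jimbo's solution of type `X_l` with parameter `q` (and, in type `B`, `v = q ^ (1/2)`). -/
def mat {K : Type*} [Field K] (X : ClassicalType) (l : ℕ) (q v : K) :
    Matrix (Fin (X.dim l) × Fin (X.dim l)) (Fin (X.dim l) × Fin (X.dim l)) K :=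
  match X with
  | .A => matA _ q
  | X => matBCD X _ q v

end Jimbo

/-! Write w for Jimbo's matrix and z = q - q⁻¹. A braiding is determined by its matrix T of values
on pairs of generators (`formMatrix`), so it suffices to show that T or its inverse is a nonzero
multiple of w. The inverse of T is again the matrix of a braiding, namely of the opposite of the
inverse (`IsBraiding.flip`, `formMatrix_mul_flip`), so the two families of the theorem are
interchanged by this symmetry.

Every matrix commuting with w is the degree two part of a functional on the FRT bialgebra
(`exists_functional`). The braiding axiom for such functionals says that T lies in the bicommutant
of w (`formMatrix_commute`), hence is a polynomial in w. In type A, w satisfies w² = 1 - z w, so T =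
α + β w. In types B, C, D the operator C = w² + z w - 1 (`contraction`) has image in a line which w
preserves, so w is cubic and T = α + β w + γ C.

The coefficients are then pinned down by single entries of two braid relations. Multiplicativity of
the braiding on the FRT relations gives `mixed_yangBaxter`, which involves w and T, and `yangBaxter`
involves T only. On two indices below the middle C is invisible, and one finds β ≠ 0 and α (α - β z)
= 0 (`hecke_alternative`). The second root corresponds to w⁻¹ = w + z, so after passing to the
opposite inverse if necessary α = 0 (`hecke_coeff`). One more mixed entry, of weight different from
zero in its outer pairs, forces γ = 0 (`coeff_contraction_eq_zero`). -/

/-! ### Pullbacks of functionals, and the opposite of the inverse braiding -/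

namespace Braiding

open TensorProduct LinearMap

variable {K H : Type*} [Field K] [Ring H] [Bialgebra K H]

section Pullback

variable {C D : Type*} [AddCommGroup C] [Module K C] [Coalgebra K C]
  [AddCommGroup D] [Module K D] [Coalgebra K D]

/-- Pullback of functionals along a coalgebra homomorphism. -/
noncomputable def pullback (f : C →ₗc[K] D) :
    WithConv (D →ₗ[K] K) →* WithConv (C →ₗ[K] K) where
  toFun X := WithConv.toConv (X.ofConv ∘ₗ f.toLinearMap)
  map_one' := by
    ext x
    simp
  map_mul' X Y := by
    apply WithConv.ext
    exact LinearMap.convMul_comp_coalgHom_distrib X Y f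

theorem pullback_apply (f : C →ₗc[K] D) (X : WithConv (D →ₗ[K] K)) (c : C) :
    (pullback f X).ofConv c = X.ofConv (f c) := rfl

end Pullback

variable (K H) in
/-- The cyclic permutation `a ⊗ b ⊗ c ↦ c ⊗ a ⊗ b`. -/
noncomputable def cycle : (H ⊗[K] H) ⊗[K] H →ₗc[K] (H ⊗[K] H) ⊗[K] H :=
  ((Coalgebra.TensorProduct.assoc K K H H H).symm : H ⊗[K] (H ⊗[K] H) →ₗc[K] _).comp
    (Bialgebra.TensorProduct.comm K (H ⊗[K] H) H : (H ⊗[K] H) ⊗[K] H →ₗc[K] H ⊗[K] (H ⊗[K] H))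

@[simp] theorem cycle_tmul (a b c : H) :
    cycle K H ((a ⊗ₜ[K] b) ⊗ₜ[K] c) = (c ⊗ₜ[K] a) ⊗ₜ[K] b := rfl

variable (K H) in
/-- The swap as a coalgebra homomorphism. -/
noncomputable def swap : H ⊗[K] H →ₗc[K] H ⊗[K] H :=
  (Bialgebra.TensorProduct.comm K H H : H ⊗[K] H →ₗc[K] H ⊗[K] H)

@[simp] theorem swap_tmul (a b : H) : swap K H (a ⊗ₜ[K] b) = b ⊗ₜ[K] a := rfl

variable (K H) in
/-- The homomorphism `a ⊗ b ⊗ c ↦ ε(c) a ⊗ b`. -/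
noncomputable def proj12 : (H ⊗[K] H) ⊗[K] H →ₗc[K] H ⊗[K] H :=
  ((Coalgebra.TensorProduct.rid K K (H ⊗[K] H)) : (H ⊗[K] H) ⊗[K] K →ₗc[K] _).comp
    (Coalgebra.TensorProduct.map (.id K _) (Bialgebra.counitBialgHom K H : H →ₗc[K] K))

@[simp] theorem proj12_tmul (x : H ⊗[K] H) (c : H) :
    proj12 K H (x ⊗ₜ[K] c) = Coalgebra.counit (R := K) c • x := rfl

theorem flip_eq (Z : WithConv (H ⊗[K] H →ₗ[K] K)) : flip Z = pullback (swap K H) Z := rfl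

/-- Legs are pullbacks along coalgebra homomorphisms, so identities between them follow from the
multiplicativity of `pullback`, without computing with coproducts. -/
theorem leg12_eq (Z : WithConv (H ⊗[K] H →ₗ[K] K)) : leg12 Z = pullback (proj12 K H) Z := by
  apply WithConv.ext
  refine TensorProduct.ext_threefold fun a b c => ?_
  simp [leg12, pullback_apply, mul_comm]

theorem leg13_eq (Z : WithConv (H ⊗[K] H →ₗ[K] K)) :
    leg13 Z = pullback ((proj12 K H).comp (cycle K H)) (flip Z) := by
  apply WithConv.ext
  refine TensorProduct.ext_threefold fun a b c => ?_
  simp [leg13, leg12, flip_eq, pullback_apply, mul_comm]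

theorem leg23_eq (Z : WithConv (H ⊗[K] H →ₗ[K] K)) :
    leg23 Z = pullback ((proj12 K H).comp ((cycle K H).comp (cycle K H))) Z := by
  apply WithConv.ext
  refine TensorProduct.ext_threefold fun a b c => ?_
  simp [leg23, pullback_apply]

theorem pullback_comp {C D F : Type*} [AddCommGroup C] [Module K C] [Coalgebra K C]
    [AddCommGroup D] [Module K D] [Coalgebra K D] [AddCommGroup F] [Module K F] [Coalgebra K F]
    (g : D →ₗc[K] F) (f : C →ₗc[K] D) (X : WithConv (F →ₗ[K] K)) :
    pullback (g.comp f) X = pullback f (pullback g X) := rfl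

theorem flip_flip (Z : WithConv (H ⊗[K] H →ₗ[K] K)) : flip (flip Z) = Z := by
  apply WithConv.ext
  refine TensorProduct.ext' fun a b => ?_
  simp [flip_eq, pullback_apply]

theorem leg12_cycle (Z : WithConv (H ⊗[K] H →ₗ[K] K)) :
    pullback (cycle K H) (leg12 Z) = leg13 (flip Z) := by
  rw [leg12_eq, leg13_eq, flip_flip, pullback_comp]

theorem leg13_cycle (Z : WithConv (H ⊗[K] H →ₗ[K] K)) :
    pullback (cycle K H) (leg13 Z) = leg23 (flip Z) := by
  rw [leg13_eq, leg23_eq]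
  rfl

theorem leg13_cycle_cycle (Z : WithConv (H ⊗[K] H →ₗ[K] K)) :
    pullback ((cycle K H).comp (cycle K H)) (leg13 Z) = leg12 (flip Z) := by
  rw [leg13_eq, leg12_eq]
  apply WithConv.ext
  refine TensorProduct.ext_threefold fun a b c => ?_
  simp [pullback_apply]

theorem leg23_cycle_cycle (Z : WithConv (H ⊗[K] H →ₗ[K] K)) :
    pullback ((cycle K H).comp (cycle K H)) (leg23 Z) = leg13 (flip Z) := by
  rw [leg13_eq, leg23_eq, flip_flip]
  apply WithConv.ext
  refine TensorProduct.ext_threefold fun a b c => ?_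
  simp [pullback_apply]

end Braiding

namespace IsBraiding

open Braiding

variable {K H : Type*} [Field K] [Ring H] [Bialgebra K H]
  {Rp Rm : WithConv (H ⊗[K] H →ₗ[K] K)}

/-- Multiplication is a coalgebra map, so pulling back along it preserves convolution inverses. Both
sides are inverse to (m ⊗ id)^*(R⁺) = R⁺₁₃ R⁺₂₃, whence the reversed order of the legs. -/
theorem inv_mul_left (h : IsBraiding Rp Rm) :
    WithConv.toConv (Rm.ofConv ∘ₗ TensorProduct.map (LinearMap.mul' K H) LinearMap.id) =
      leg23 Rm * leg13 Rm := by
  let f : (H ⊗[K] H) ⊗[K] H →ₗc[K] H ⊗[K] H :=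
    Coalgebra.TensorProduct.map (Bialgebra.mulCoalgHom K H) (.id K H)
  have h13 : leg13 Rp * leg13 Rm = 1 := by
    rw [leg13_eq, leg13_eq, ← map_mul, flip_eq, flip_eq, ← map_mul, h.mul_inv, map_one, map_one]
  have h23 : leg23 Rp * leg23 Rm = 1 := by
    rw [leg23_eq, leg23_eq, ← map_mul, h.mul_inv, map_one]
  have hf : pullback f Rp = leg13 Rp * leg23 Rp := h.mul_left
  have hl : pullback f Rm * pullback f Rp = 1 := by rw [← map_mul, h.inv_mul, map_one]
  have hr : pullback f Rp * (leg23 Rm * leg13 Rm) = 1 := by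
    rw [hf, mul_assoc, ← mul_assoc (leg23 Rp), h23, one_mul, h13]
  exact left_inv_eq_right_inv hl hr

theorem inv_mul_right (h : IsBraiding Rp Rm) :
    WithConv.toConv (Rm.ofConv ∘ₗ TensorProduct.map LinearMap.id (LinearMap.mul' K H) ∘ₗ
        (TensorProduct.assoc K H H H).toLinearMap) = leg12 Rm * leg13 Rm := by
  let f : (H ⊗[K] H) ⊗[K] H →ₗc[K] H ⊗[K] H :=
    (Coalgebra.TensorProduct.map (.id K H) (Bialgebra.mulCoalgHom K H)).comp
      (Coalgebra.TensorProduct.assoc K K H H H : _ →ₗc[K] H ⊗[K] (H ⊗[K] H))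
  have h13 : leg13 Rp * leg13 Rm = 1 := by
    rw [leg13_eq, leg13_eq, ← map_mul, flip_eq, flip_eq, ← map_mul, h.mul_inv, map_one, map_one]
  have h12 : leg12 Rp * leg12 Rm = 1 := by
    rw [leg12_eq, leg12_eq, ← map_mul, h.mul_inv, map_one]
  have hf : pullback f Rp = leg13 Rp * leg12 Rp := h.mul_right
  have hl : pullback f Rm * pullback f Rp = 1 := by rw [← map_mul, h.inv_mul, map_one]
  have hr : pullback f Rp * (leg12 Rm * leg13 Rm) = 1 := by
    rw [hf, mul_assoc, ← mul_assoc (leg12 Rp), h12, one_mul, h13]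
  exact left_inv_eq_right_inv hl hr

/-- The opposite of the inverse of a braiding is a braiding. -/
theorem flip (h : IsBraiding Rp Rm) : IsBraiding (flip Rm) (flip Rp) where
  mul_inv := by rw [flip_eq, flip_eq, ← map_mul, h.inv_mul, map_one]
  inv_mul := by rw [flip_eq, flip_eq, ← map_mul, h.mul_inv, map_one]
  braided X := by
    have h1 : Rm * WithConv.toConv (X ∘ₗ LinearMap.mul' K H ∘ₗ
        (TensorProduct.comm K H H).toLinearMap) * Rp =
        WithConv.toConv (X ∘ₗ LinearMap.mul' K H) := by
      rw [← h.braided X, mul_assoc, mul_assoc, h.inv_mul, mul_one, ← mul_assoc, h.inv_mul, one_mul]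
    have h2 := congrArg (pullback (swap K H)) h1
    rw [map_mul, map_mul] at h2
    have h3 : WithConv.toConv (X ∘ₗ LinearMap.mul' K H) =
        pullback (swap K H) (WithConv.toConv (X ∘ₗ LinearMap.mul' K H ∘ₗ
          (TensorProduct.comm K H H).toLinearMap)) := by
      apply WithConv.ext
      refine TensorProduct.ext' fun a b => ?_
      simp [pullback_apply]
    rw [flip_eq, flip_eq, h3]
    exact h2
  mul_left := by
    -- Flipping the form exchanges the two multiplicativity axioms; the cyclic permutation moves the
    -- legs of one identity onto those of the other.
    have h1 := congrArg (pullback (cycle K H)) h.inv_mul_right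
    rw [map_mul, leg12_cycle, leg13_cycle] at h1
    rw [← h1]
    apply WithConv.ext
    refine TensorProduct.ext_threefold fun a b c => ?_
    simp [pullback_apply, flip_eq]
  mul_right := by
    have h1 := congrArg (pullback ((cycle K H).comp (cycle K H))) h.inv_mul_left
    rw [map_mul, leg23_cycle_cycle, leg13_cycle_cycle] at h1
    rw [← h1]
    apply WithConv.ext
    refine TensorProduct.ext_threefold fun a b c => ?_
    simp [pullback_apply, flip_eq]

end IsBraiding

/-! ### Functionals on the degree two part of the FRT bialgebra -/

namespace FRT

variable {K n : Type*} [Field K] [Fintype n] [DecidableEq n] {w : Matrix (n × n) (n × n) K}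

theorem comul_t (i j : n) :
    Coalgebra.comul (R := K) (t w i j) = ∑ k, t w i k ⊗ₜ[K] t w k j := comulHom_t w i j

theorem counit_t (i j : n) :
    Coalgebra.counit (R := K) (t w i j) = if i = j then 1 else 0 := counitHom_t w i j

theorem convMul_apply_t (Y Z : WithConv (FRT w ⊗[K] FRT w →ₗ[K] K)) (p q r s : n) :
    (Y * Z).ofConv (t w p q ⊗ₜ[K] t w r s) =
      ∑ k, ∑ l, Y.ofConv (t w p k ⊗ₜ[K] t w r l) * Z.ofConv (t w k q ⊗ₜ[K] t w l s) := by
  have := LinearMap.convMul_apply Y Z (t w p q ⊗ₜ[K] t w r s)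
  rw [TensorProduct.comul_tmul, comul_t, comul_t] at this
  refine this.trans ?_
  simp [TensorProduct.tmul_sum, TensorProduct.sum_tmul]
  exact Finset.sum_comm

/-- The matrix `(r, p), (q, s) ↦ Z (t p q ⊗ t r s)` of a form. -/
noncomputable def formMatrix (Z : WithConv (FRT w ⊗[K] FRT w →ₗ[K] K)) :
    Matrix (n × n) (n × n) K :=
  fun x y => Z.ofConv (t w x.2 y.1 ⊗ₜ[K] t w x.1 y.2)

/-- The action of `t i j` on `K ⊕ Mat ⊕ K` recording the values of `M` in degree two. -/
noncomputable def degreeTwoGen (M : Matrix (n × n) (n × n) K) (i j : n) :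
    Module.End K (K × Matrix n n K × K) where
  toFun x := (0, x.1 • Matrix.single i j 1, ∑ b, ∑ c, M (i, b) (j, c) * x.2.1 b c)
  map_add' x y := by
    simp [add_smul, mul_add, Finset.sum_add_distrib]
  map_smul' k x := by
    simp [Finset.mul_sum, mul_smul, mul_left_comm]

/-- The representation with generators `degreeTwoGen M`, for `M` commuting with `w`. -/
noncomputable def degreeTwo (M : Matrix (n × n) (n × n) K) (hM : Commute w M) :
    FRT w →ₐ[K] Module.End K (K × Matrix n n K × K) :=
  RingQuot.liftAlgHom K
    ⟨FreeAlgebra.lift K (fun x : n × n => degreeTwoGen M x.1 x.2), by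
      rintro _ _ ⟨a, b, p, q⟩
      -- A product of two generators only maps the first coordinate to the third, by an entry of M,
      -- so the FRT relations amount to the entries of w M = M w.
      have h := congrFun (congrFun hM.eq (a, b)) (p, q)
      simp only [Matrix.mul_apply, Fintype.sum_prod_type] at h
      apply LinearMap.ext
      rintro ⟨x, m, y⟩
      have : x * ∑ c, ∑ d, w (a, b) (c, d) * M (c, d) (p, q) =
        x * ∑ c, ∑ d, w (c, d) (p, q) * M (a, b) (c, d) := by
        rw [h]; simp only [mul_comm]
      simpa [degreeTwoGen, Matrix.single_apply, Prod.ext_iff, ite_and, Finset.mul_sum,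
        mul_left_comm, mul_comm, Prod.fst_sum, Prod.snd_sum] using this⟩

/-- A functional with `t a p * t b q ↦ M (a, b) (p, q)`, for `M` commuting with `w`. -/
theorem exists_functional (M : Matrix (n × n) (n × n) K) (hM : Commute w M) :
    ∃ X : FRT w →ₗ[K] K, ∀ a b p q, X (t w a p * t w b q) = M (a, b) (p, q) := by
  -- On (1, 0, 0), `t b q` gives the matrix unit at (b, q), which `t a p` pairs with M; the last
  -- coordinate is then M (a, b) (p, q).
  refine ⟨(LinearMap.snd K (Matrix n n K) K ∘ₗ LinearMap.snd K K _) ∘ₗ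
    (LinearMap.applyₗ ((1, 0, 0) : K × Matrix n n K × K)) ∘ₗ (degreeTwo M hM).toLinearMap, ?_⟩
  intro a b p q
  have h : ∀ i j, degreeTwo M hM (t w i j) = degreeTwoGen M i j := fun i j => by
    simp [degreeTwo, t]
  simp [h, degreeTwoGen, Matrix.single_apply, ite_and]

end FRT

/-! ### The matrix of a braiding: bicommutant and braid relations -/

namespace IsBraiding

open FRT

variable {K n : Type*} [Field K] [Fintype n] [DecidableEq n] {w : Matrix (n × n) (n × n) K}
  {Rp Rm : WithConv (FRT w ⊗[K] FRT w →ₗ[K] K)}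

/-- The matrix of a braiding satisfies the FRT relations. -/
theorem formMatrix_rel (h : IsBraiding Rp Rm) (X : FRT w →ₗ[K] K) (a b p q : n) :
    ∑ c, ∑ d, formMatrix Rp (a, b) (c, d) * X (t w c p * t w d q) =
      ∑ r, ∑ s, formMatrix Rp (r, s) (p, q) * X (t w a r * t w b s) := by
  have h1 : Rp * WithConv.toConv (X ∘ₗ LinearMap.mul' K (FRT w)) =
      WithConv.toConv (X ∘ₗ LinearMap.mul' K _ ∘ₗ (TensorProduct.comm K _ _).toLinearMap) * Rp := by
    rw [← h.braided X, mul_assoc, mul_assoc, h.inv_mul, mul_one]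
  have h2 := congrArg (fun Z => Z.ofConv (t w b p ⊗ₜ[K] t w a q)) h1
  simp only [convMul_apply_t] at h2
  rw [Finset.sum_comm (f := fun r s => formMatrix Rp (r, s) (p, q) * X (t w a r * t w b s))]
  simpa [formMatrix, mul_comm (X _)] using h2

/-- For a functional whose degree two part is M, `formMatrix_rel` reads T M = M T. Thus T belongs to
the bicommutant of w. -/
theorem formMatrix_commute (h : IsBraiding Rp Rm) {M : Matrix (n × n) (n × n) K}
    (hM : Commute w M) : Commute (formMatrix Rp) M := by
  obtain ⟨X, hX⟩ := exists_functional M hM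
  ext ⟨a, b⟩ ⟨p, q⟩
  have := h.formMatrix_rel X a b p q
  simp only [hX] at this
  simpa [Matrix.mul_apply, Fintype.sum_prod_type, mul_comm] using this

theorem apply_t_mul (h : IsBraiding Rp Rm) (x y c p d q : n) :
    Rp.ofConv (t w x y ⊗ₜ[K] (t w c p * t w d q)) =
      ∑ k, formMatrix Rp (d, x) (k, q) * formMatrix Rp (c, k) (y, p) :=
  h.apply_mul_right _ _ _
    ⟨Finset.univ, fun k => FRT.t w x k, fun k => FRT.t w k y, (comul_t x y).symm⟩

/-- `w₁₂ T₂₃ T₁₂ = T₂₃ T₁₂ w₂₃` for the matrix `T` of a braiding. -/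
theorem mixed_yangBaxter (h : IsBraiding Rp Rm) (a b x y p q : n) :
    ∑ c, ∑ d, w (a, b) (c, d) *
        ∑ k, formMatrix Rp (d, x) (k, q) * formMatrix Rp (c, k) (y, p) =
      ∑ r, ∑ s, w (r, s) (p, q) *
        ∑ k, formMatrix Rp (b, x) (k, s) * formMatrix Rp (a, k) (y, r) := by
  have h1 := congrArg (fun z => Rp.ofConv (t w x y ⊗ₜ[K] z)) (t_rel w a b p q)
  simpa [TensorProduct.tmul_sum, h.apply_t_mul] using h1

/-- `T₁₂ T₂₃ T₁₂ = T₂₃ T₁₂ T₂₃` for the matrix `T` of a braiding. -/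
theorem yangBaxter (h : IsBraiding Rp Rm) (a b x y p q : n) :
    ∑ c, ∑ d, formMatrix Rp (a, b) (c, d) *
        ∑ k, formMatrix Rp (d, x) (k, q) * formMatrix Rp (c, k) (y, p) =
      ∑ r, ∑ s, formMatrix Rp (r, s) (p, q) *
        ∑ k, formMatrix Rp (b, x) (k, s) * formMatrix Rp (a, k) (y, r) := by
  -- The functional R⁺(t x y ⊗ ·) is multiplied out on t · t by `apply_t_mul`, so the FRT relation
  -- for T becomes a braid relation.
  have h1 := h.formMatrix_rel (Rp.ofConv ∘ₗ TensorProduct.mk K _ _ (t w x y)) a b p q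
  simpa [h.apply_t_mul] using h1

/-- The index order of `formMatrix` includes a swap, so convolution with R⁻ becomes multiplication
by the matrix of R⁻₂₁. Passing to the opposite inverse therefore inverts the matrix. -/
theorem formMatrix_mul_flip (h : IsBraiding Rp Rm) :
    formMatrix Rp * formMatrix (Braiding.flip Rm) = 1 := by
  ext ⟨r, p⟩ ⟨s, q⟩
  have h1 := congrArg (fun Z => Z.ofConv (t w p q ⊗ₜ[K] t w r s)) h.mul_inv
  simp only [convMul_apply_t] at h1
  simp only [Matrix.mul_apply, Fintype.sum_prod_type, Matrix.one_apply]
  refine h1.trans ?_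
  by_cases hpq : p = q <;> by_cases hrs : r = s <;> simp [counit_t, hpq, hrs]

/-- A braiding whose matrix is proportional to `w` is a canonical braiding. -/
theorem isCanonicalBraiding (h : IsBraiding Rp Rm) {η : K} (hT : formMatrix Rp = η • w) :
    IsCanonicalBraiding w η Rp Rm where
  toIsBraiding := h
  apply_t p q r s := congrFun (congrFun hT (r, p)) (q, s)

end IsBraiding

/-! ### Bicommutants of operators with quadratic or cubic minimal polynomial -/

namespace Matrix

variable {K m : Type*} [Field K] [Fintype m] [DecidableEq m] {w T : Matrix m m K} {e u : m → K}

/-- An element `T` of the bicommutant of `w` is determined by its value on a vector `e` which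
the commutant of `w` maps to every vector. -/
theorem eq_of_mem_bicommutant (hT : ∀ M, Commute w M → Commute T M)
    (he : ∀ v, ∃ φ, Commute w φ ∧ φ *ᵥ e = v) {F : Matrix m m K}
    (hF : ∀ M, Commute w M → Commute F M) (h : T *ᵥ e = F *ᵥ e) : T = F := by
  refine ext_of_mulVec_single fun i => ?_
  obtain ⟨φ, hφ, hi⟩ := he (Pi.single i 1)
  rw [← hi, mulVec_mulVec, mulVec_mulVec, (hT φ hφ).eq, (hF φ hφ).eq, ← mulVec_mulVec, h,
    mulVec_mulVec]

/-- The bicommutant of `w`, when `w` has a quadratic minimal polynomial. -/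
theorem exists_of_mem_bicommutant_quadratic (hT : ∀ M, Commute w M → Commute T M)
    {m0 m1 : K} (hw : w * w = m0 • 1 + m1 • w)
    (h0 : u ⬝ᵥ e = 0) (h1 : u ⬝ᵥ (w *ᵥ e) = 1) :
    ∃ a b : K, T = a • 1 + b • w := by
  -- For p(x) = x² - m1 x - m0, this is (p(L) - p(R)) / (L - R) applied to v uᵀ, where L and R are
  -- left and right multiplication by w. Its commutator with w is p(w) v uᵀ - v uᵀ p(w) = 0.
  let φ : (m → K) → Matrix m m K := fun v =>
    vecMulVec v u * w + (w - m1 • 1) * vecMulVec v u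
  have hφ : ∀ v, Commute w (φ v) := by
    intro v
    have h2 : w * φ v - φ v * w = (w * w - m1 • w) * vecMulVec v u -
        vecMulVec v u * (w * w - m1 • w) := by
      simp only [φ, smul_mul_assoc, mul_smul_comm, one_mul, sub_mul, mul_sub, mul_add,
        add_mul, mul_assoc]
      abel
    rw [hw, add_sub_cancel_right] at h2
    exact sub_eq_zero.mp (by rw [h2]; simp)
  have hφe : ∀ v, φ v *ᵥ e = v := by
    intro v
    simp [φ, add_mulVec, ← mulVec_mulVec, vecMulVec_mulVec, h0, h1]
  -- Since φ e fixes e and commutes with T, it fixes T e; but φ e sends every vector to a polynomial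
  -- in w applied to e. The coefficients below are read off from this.
  have hTe : T *ᵥ e = φ e *ᵥ (T *ᵥ e) := by
    conv_lhs => rw [← hφe e]
    rw [mulVec_mulVec, mulVec_mulVec, (hT _ (hφ e)).eq]
  refine ⟨u ⬝ᵥ (w *ᵥ (T *ᵥ e)) - m1 * (u ⬝ᵥ (T *ᵥ e)), u ⬝ᵥ (T *ᵥ e),
    eq_of_mem_bicommutant hT (fun v => ⟨φ v, hφ v, hφe v⟩) ?_ ?_⟩
  · intro M hM
    exact ((Commute.one_left M).smul_left _).add_left (hM.smul_left _)
  · refine hTe.trans ?_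
    simp only [φ, add_mulVec, sub_mulVec, ← mulVec_mulVec, vecMulVec_mulVec, smul_mulVec,
      one_mulVec, mulVec_smul, op_smul_eq_smul]
    module

/-- The bicommutant of `w`, when `w` has a cubic minimal polynomial. -/
theorem exists_of_mem_bicommutant_cubic (hT : ∀ M, Commute w M → Commute T M)
    {m0 m1 m2 : K} (hw : w * (w * w) = m0 • 1 + m1 • w + m2 • (w * w))
    (h0 : u ⬝ᵥ e = 0) (h1 : u ⬝ᵥ (w *ᵥ e) = 0) (h2 : u ⬝ᵥ (w *ᵥ (w *ᵥ e)) = 1) :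
    ∃ a b c : K, T = a • 1 + b • w + c • (w * w) := by
  -- As in the quadratic case, with p(x) = x³ - m2 x² - m1 x - m0 and the divided difference x² + x
  -- y + y² - m2 (x + y) - m1.
  let φ : (m → K) → Matrix m m K := fun v =>
    vecMulVec v u * (w * w) + (w - m2 • 1) * (vecMulVec v u * w) +
      (w * w - m2 • w - m1 • 1) * vecMulVec v u
  have hφ : ∀ v, Commute w (φ v) := by
    intro v
    have h2 : w * φ v - φ v * w = (w * (w * w) - m1 • w - m2 • (w * w)) * vecMulVec v u -
        vecMulVec v u * (w * (w * w) - m1 • w - m2 • (w * w)) := by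
      simp only [φ, smul_mul_assoc, mul_smul_comm, one_mul, sub_mul, mul_sub, mul_add,
        add_mul, mul_assoc]
      abel
    have h3 : w * (w * w) - m1 • w - m2 • (w * w) = m0 • 1 := by rw [hw]; abel
    rw [h3] at h2
    exact sub_eq_zero.mp (by rw [h2]; simp)
  have hφe : ∀ v, φ v *ᵥ e = v := by
    intro v
    simp [φ, add_mulVec, ← mulVec_mulVec, vecMulVec_mulVec, h0, h1, h2]
  have hTe : T *ᵥ e = φ e *ᵥ (T *ᵥ e) := by
    conv_lhs => rw [← hφe e]
    rw [mulVec_mulVec, mulVec_mulVec, (hT _ (hφ e)).eq]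
  refine ⟨u ⬝ᵥ (w *ᵥ (w *ᵥ (T *ᵥ e))) - m2 * (u ⬝ᵥ (w *ᵥ (T *ᵥ e))) - m1 * (u ⬝ᵥ (T *ᵥ e)),
    u ⬝ᵥ (w *ᵥ (T *ᵥ e)) - m2 * (u ⬝ᵥ (T *ᵥ e)), u ⬝ᵥ (T *ᵥ e),
    eq_of_mem_bicommutant hT (fun v => ⟨φ v, hφ v, hφe v⟩) ?_ ?_⟩
  · intro M hM
    exact (((Commute.one_left M).smul_left _).add_left (hM.smul_left _)).add_left
      ((hM.mul_left hM).smul_left _)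
  · refine hTe.trans ?_
    simp only [φ, add_mulVec, sub_mulVec, ← mulVec_mulVec, vecMulVec_mulVec, smul_mulVec,
      one_mulVec, mulVec_smul, op_smul_eq_smul]
    module

end Matrix

/-! ### Entries of Jimbo's matrices -/

namespace Jimbo

open scoped Kronecker

variable {K : Type*} [Field K] {N : ℕ}

theorem E_kronecker_E_apply (r s k l a b c d : Fin N) :
    (E K r s ⊗ₖ E K k l) (a, b) (c, d) = if (r = a ∧ s = c) ∧ k = b ∧ l = d then 1 else 0 := by
  rw [Matrix.kroneckerMap_apply, E, E, Matrix.single_apply, Matrix.single_apply]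
  split_ifs <;> simp_all

theorem ite_matrix_apply {m α : Type*} (p : Prop) [Decidable p] (A B : Matrix m m α) (x y : m) :
    (if p then A else B) x y = if p then A x y else B x y := by
  split_ifs <;> rfl

theorem sum_apply_of_forall_ne {m : Type*} {f : Fin N → Matrix m m K} {x y : m} (a : Fin N)
    (h : ∀ r, r ≠ a → f r x y = 0) : (∑ r, f r) x y = f a x y := by
  rw [Matrix.sum_apply]
  exact Fintype.sum_eq_single a h

theorem sum_sum_apply_of_forall_ne {m : Type*} {f : Fin N → Fin N → Matrix m m K} {x y : m}
    (a b : Fin N) (h : ∀ r s, ¬ (r = a ∧ s = b) → f r s x y = 0) :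
    (∑ r, ∑ s, f r s) x y = f a b x y := by
  rw [sum_apply_of_forall_ne a, sum_apply_of_forall_ne b]
  · exact fun s hs => h a s fun h => hs h.2
  · intro r hr
    rw [Matrix.sum_apply]
    exact Finset.sum_eq_zero fun s _ => h r s fun h => hr h.1

set_option linter.unusedSimpArgs false in
theorem matA_apply (q : K) (a b c d : Fin N) :
    matA N q (a, b) (c, d) =
      if a = b then (if c = a ∧ d = a then q⁻¹ else 0)
      else (if c = b ∧ d = a then 1 else 0)
        - (if b < a then (if c = a ∧ d = b then q - q⁻¹ else 0) else 0) := by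
  rw [matA, Matrix.sub_apply, Matrix.add_apply, Matrix.smul_apply, Matrix.smul_apply,
    sum_apply_of_forall_ne a, sum_sum_apply_of_forall_ne a b, sum_sum_apply_of_forall_ne a b]
  · simp only [ite_matrix_apply, Matrix.add_apply, Matrix.neg_apply, Matrix.smul_apply,
      Matrix.zero_apply, E_kronecker_E_apply, smul_eq_mul]
    grind
  · intro r s h
    simp only [ite_matrix_apply, Matrix.add_apply, Matrix.neg_apply, Matrix.smul_apply,
      Matrix.zero_apply, E_kronecker_E_apply, smul_eq_mul]
    grind
  · intro r s h
    simp only [ite_matrix_apply, Matrix.add_apply, Matrix.neg_apply, Matrix.smul_apply,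
      Matrix.zero_apply, E_kronecker_E_apply, smul_eq_mul]
    grind
  · intro r h
    simp only [ite_matrix_apply, Matrix.add_apply, Matrix.neg_apply, Matrix.smul_apply,
      Matrix.zero_apply, E_kronecker_E_apply, smul_eq_mul]
    grind

set_option linter.unusedSimpArgs false in
theorem matBCD_apply (X : ClassicalType) (q v : K) (a b c d : Fin N) :
    matBCD X N q v (a, b) (c, d) =
      if b = a.rev then
        (if c = b ∧ d = a then (if a = a.rev then 1 else q) else 0)
          - (if b < a then (if c = a ∧ d = b then q - q⁻¹ else 0) else 0)
          + (if d < a then (if c = d.rev then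
              (q - q⁻¹) * (((eps X a * eps X d : ℤ) : K) * barPow X q v a d) else 0) else 0)
      else if a = b then (if c = a ∧ d = a then q⁻¹ else 0)
      else (if c = b ∧ d = a then 1 else 0)
        - (if b < a then (if c = a ∧ d = b then q - q⁻¹ else 0) else 0) := by
  have h4 : ∀ r s : Fin N, (if s < r then
      -(E K r r ⊗ₖ E K s s)
        + (((eps X r * eps X s : ℤ) : K) * barPow X q v r s) •
          (E K r s.rev ⊗ₖ E K r.rev s)
      else 0) = (if s < r then -(E K r r ⊗ₖ E K s s) else 0) +
      (if s < r then (((eps X r * eps X s : ℤ) : K) * barPow X q v r s) •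
          (E K r s.rev ⊗ₖ E K r.rev s) else 0) := by
    intro r s; split_ifs <;> simp
  simp only [matBCD, h4, Finset.sum_add_distrib]
  -- At a given entry each sum has at most one nonzero term. In the last sum the row fixes r = a and
  -- the column fixes s = d.
  rw [Matrix.add_apply, Matrix.add_apply, Matrix.add_apply, Matrix.smul_apply, Matrix.add_apply,
    sum_apply_of_forall_ne a, sum_apply_of_forall_ne a, sum_sum_apply_of_forall_ne a b,
    sum_sum_apply_of_forall_ne a b, sum_sum_apply_of_forall_ne a d]
  · clear h4
    have hba : a = b.rev ↔ b = a.rev := by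
      rw [eq_comm, Fin.rev_eq_iff]
    have had : d.rev = c ↔ c = d.rev := eq_comm
    have har : a.rev = b ↔ b = a.rev := eq_comm
    simp only [ite_matrix_apply, Matrix.add_apply, Matrix.neg_apply, Matrix.smul_apply,
      Matrix.zero_apply, E_kronecker_E_apply, smul_eq_mul]
    simp only [hba, had, har]
    grind
  · intro r s h
    simp only [ite_matrix_apply, Matrix.add_apply, Matrix.neg_apply, Matrix.smul_apply,
      Matrix.zero_apply, E_kronecker_E_apply, smul_eq_mul]
    grind
  · intro r s h
    simp only [ite_matrix_apply, Matrix.add_apply, Matrix.neg_apply, Matrix.smul_apply,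
      Matrix.zero_apply, E_kronecker_E_apply, smul_eq_mul]
    grind
  · intro r s h
    simp only [ite_matrix_apply, Matrix.add_apply, Matrix.neg_apply, Matrix.smul_apply,
      Matrix.zero_apply, E_kronecker_E_apply, smul_eq_mul]
    grind
  · intro r h
    simp only [ite_matrix_apply, Matrix.add_apply, Matrix.neg_apply, Matrix.smul_apply,
      Matrix.zero_apply, E_kronecker_E_apply, smul_eq_mul]
    grind
  · intro r h
    simp only [ite_matrix_apply, Matrix.add_apply, Matrix.neg_apply, Matrix.smul_apply,
      Matrix.zero_apply, E_kronecker_E_apply, smul_eq_mul]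
    grind

end Jimbo

/-! ### The action on weight zero vectors -/

namespace Jimbo

variable {K : Type*} [Field K] {N : ℕ}

theorem eq_of_forall_succ {α : Type*} {g : Fin N → α}
    (h : ∀ a b : Fin N, (b : ℕ) = a + 1 → g b = g a) (a b : Fin N) : g a = g b := by
  have key : ∀ (k : ℕ) (hk : k < N), g ⟨k, hk⟩ = g ⟨0, by omega⟩ := by
    intro k
    induction k with
    | zero => intro _; rfl
    | succ k ih => intro hk; rw [← ih (by omega)]; exact h ⟨k, by omega⟩ _ rfl
  exact (key a a.2).trans (key b b.2).symm

/-- The ratios `r a = x a' / x a` of the weights occurring in Jimbo's matrix. -/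
structure IsRatio (q : K) (r : Fin N → K) : Prop where
  self : ∀ a, a = a.rev → r a = 1
  mul_rev : ∀ a, r a * r a.rev = 1
  lower : ∀ a b : Fin N, (b : ℕ) = a + 1 → b < b.rev → r a = q ^ 2 * r b
  even : ∀ a b : Fin N, (b : ℕ) = a + 1 → b = a.rev → r a = 1 ∨ r a = -q ^ 2
  odd : ∀ a b : Fin N, (b : ℕ) = a + 1 → b = b.rev → r a = q

/-- The action of Jimbo's matrix on the vectors of weight zero, in rescaled coordinates. -/
def zeroWeight (q : K) (r : Fin N → K) (F : Fin N → K) (a : Fin N) : K :=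
  (if a = a.rev then 1 else q) * (r a * F a.rev) - (if a.rev < a then (q - q⁻¹) * F a else 0) +
    (q - q⁻¹) * ∑ s ∈ Finset.Iio a, r s * F s.rev

variable {q : K} {r : Fin N → K}

/-- The partial sums in `zeroWeight` gain one term at each step, so neighbouring values differ by a
local expression. Constancy statements are checked on such differences. -/
theorem zeroWeight_succ (F : Fin N → K) {a b : Fin N} (hb : (b : ℕ) = a + 1) :
    zeroWeight q r F b = zeroWeight q r F a +
      ((if b = b.rev then 1 else q) * (r b * F b.rev) -
        (if b.rev < b then (q - q⁻¹) * F b else 0) -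
      ((if a = a.rev then 1 else q) * (r a * F a.rev) -
        (if a.rev < a then (q - q⁻¹) * F a else 0)) + (q - q⁻¹) * (r a * F a.rev)) := by
  have h : Finset.Iio b = insert a (Finset.Iio a) := by
    ext s; simp only [Finset.mem_Iio, Finset.mem_insert, Fin.lt_def, Fin.ext_iff]; omega
  rw [zeroWeight, zeroWeight, h, Finset.sum_insert (by simp)]
  ring

theorem IsRatio.upper (hr : IsRatio q r) {a b : Fin N} (hb : (b : ℕ) = a + 1) (ha : a.rev < a) :
    r a = q ^ 2 * r b := by
  have h1 := hr.lower b.rev a.rev (by simp [Fin.val_rev]; omega) (by simpa using ha)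
  have h2 := hr.mul_rev a
  have h3 := hr.mul_rev b
  rw [h1] at h3
  linear_combination (-r a) * h3 + q ^ 2 * r b * h2

theorem zeroWeight_lower (hq : q ≠ 0) (hr : IsRatio q r) (F : Fin N → K) {a b : Fin N}
    (hb : (b : ℕ) = a + 1) (h : b < b.rev) :
    zeroWeight q r F b = zeroWeight q r F a + q⁻¹ * r a * (F b.rev - F a.rev) := by
  have h1 : b ≠ b.rev := h.ne
  have h2 : ¬ b.rev < b := h.not_gt
  have h3 : a < a.rev := by simp only [Fin.lt_def, Fin.val_rev] at *; omega
  have h4 : a ≠ a.rev := h3.ne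
  have h5 : ¬ a.rev < a := h3.not_gt
  rw [zeroWeight_succ F hb, if_neg h1, if_neg h2, if_neg h4, if_neg h5, hr.lower a b hb h]
  field_simp
  ring

theorem zeroWeight_upper (hq : q ≠ 0) (hr : IsRatio q r) (F : Fin N → K) {a b : Fin N}
    (hb : (b : ℕ) = a + 1) (h : a.rev < a) :
    zeroWeight q r F b = zeroWeight q r F a + q⁻¹ * r a * (F b.rev - F a.rev) -
      (q - q⁻¹) * (F b - F a) := by
  have h1 : a ≠ a.rev := h.ne'
  have h2 : b.rev < b := by simp only [Fin.lt_def, Fin.val_rev] at *; omega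
  have h3 : b ≠ b.rev := h2.ne'
  rw [zeroWeight_succ F hb, if_neg h1, if_pos h2, if_neg h3, if_pos h, hr.upper hb h]
  field_simp
  ring

theorem zeroWeight_even (F : Fin N → K) {a b : Fin N} (hb : (b : ℕ) = a + 1) (h : b = a.rev) :
    zeroWeight q r F b = zeroWeight q r F a + q * r b * F a - q⁻¹ * r a * F b -
      (q - q⁻¹) * F b := by
  have h0 : b.rev = a := by rw [h, Fin.rev_rev]
  have h1 : a < b := by rw [Fin.lt_def]; omega
  rw [zeroWeight_succ F hb, h0, ← h, if_neg h1.ne', if_pos h1, if_neg h1.ne, if_neg h1.not_gt]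
  ring

theorem zeroWeight_odd_lower (hq : q ≠ 0) (hr : IsRatio q r) (F : Fin N → K) {a b : Fin N}
    (hb : (b : ℕ) = a + 1) (h : b = b.rev) :
    zeroWeight q r F b = zeroWeight q r F a + F b - F a.rev := by
  have h0 : a < a.rev := by simp only [Fin.ext_iff, Fin.lt_def, Fin.val_rev] at *; omega
  have h1 : ¬ b.rev < b := by rw [← h]; exact lt_irrefl b
  rw [zeroWeight_succ F hb, if_neg h1, if_pos h, if_neg h0.ne, if_neg h0.not_gt, hr.self b h, ← h,
    hr.odd a b hb h]
  field_simp
  ring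

theorem zeroWeight_odd_upper (hq : q ≠ 0) (hr : IsRatio q r) (F : Fin N → K) {a b : Fin N}
    (hb : (b : ℕ) = a + 1) (h : a = a.rev) :
    zeroWeight q r F b = zeroWeight q r F a + F b.rev - F a + (q - q⁻¹) * (F a - F b) := by
  have h0 : b.rev < b := by simp only [Fin.ext_iff, Fin.lt_def, Fin.val_rev] at *; omega
  have h1 : ¬ a.rev < a := by rw [← h]; exact lt_irrefl a
  have h2 : q * r b = 1 := by
    have h3 := hr.odd b.rev a (by simp only [Fin.ext_iff, Fin.val_rev] at *; omega) h
    have h4 := hr.mul_rev b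
    rw [h3] at h4
    linear_combination h4
  rw [zeroWeight_succ F hb, if_neg h1, if_pos h, if_neg h0.ne', if_pos h0, hr.self a h, ← h]
  linear_combination F b.rev * h2

/-- The quadratic relation modulo constants. -/
theorem zeroWeight_quadratic (hq : q ≠ 0) (hr : IsRatio q r) (F : Fin N → K) (a b : Fin N) :
    zeroWeight q r (fun c => zeroWeight q r F c + (q - q⁻¹) * F c) a - F a =
      zeroWeight q r (fun c => zeroWeight q r F c + (q - q⁻¹) * F c) b - F b := by
  revert a b
  refine eq_of_forall_succ (g := fun a =>
    zeroWeight q r (fun c => zeroWeight q r F c + (q - q⁻¹) * F c) a - F a) fun a b hb => ?_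
  -- The outer difference from a to b involves inner differences across this step and its mirror
  -- image from `b.rev` to `a.rev` only. At the middle of an even range the step is its own mirror
  -- image.
  have hb' : (a.rev : ℕ) = b.rev + 1 := by simp only [Fin.val_rev]; omega
  have hqq : q * q⁻¹ = 1 := mul_inv_cancel₀ hq
  have ha1 := hr.mul_rev a
  have hb1 := hr.mul_rev b
  rcases lt_trichotomy b b.rev with h | h | h
  · have h1 := zeroWeight_upper hq hr F hb' (by simpa using h)
    have h2 := hr.lower a b hb h
    rw [zeroWeight_lower hq hr _ hb h]
    simp only [Fin.rev_rev] at h1 ⊢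
    rw [h1, h2]
    linear_combination (q⁻¹ * q) ^ 2 * (F b - F a) * hb1 + (q⁻¹ * q + 1) * (F b - F a) * hqq
  · have h1 := zeroWeight_odd_upper hq hr F hb' (by simpa using h.symm)
    rw [zeroWeight_odd_lower hq hr _ hb h]
    simp only [Fin.rev_rev, ← h] at h1 ⊢
    rw [h1]
    ring
  · rcases lt_trichotomy a a.rev with h' | h' | h'
    · have hba : b = a.rev := by simp only [Fin.ext_iff, Fin.lt_def, Fin.val_rev] at *; omega
      have h1 := zeroWeight_even (q := q) (r := r) F hb hba
      rw [zeroWeight_even _ hb hba, h1]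
      generalize zeroWeight q r (fun c => zeroWeight q r F c + (q - q⁻¹) * F c) a = S
      rw [← hba] at ha1
      rcases hr.even a b hb hba with h2 | h2
      · rw [h2, one_mul] at ha1
        rw [h2, ha1]
        linear_combination (F b - F a) * hqq
      · have h3 : r b = - q⁻¹ ^ 2 := by
          rw [h2] at ha1
          field_simp
          linear_combination -ha1
        rw [h2, h3]
        field_simp
        ring
    · have h1 := zeroWeight_odd_lower hq hr F hb' (by simpa using h'.symm)
      have h2 := zeroWeight_odd_upper hq hr F hb h'
      rw [zeroWeight_odd_upper hq hr _ hb h']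
      simp only [Fin.rev_rev, ← h'] at h1 ⊢
      rw [h2, h1]
      ring
    · have h1 := zeroWeight_lower hq hr F hb' (by simpa using h')
      have h2 := zeroWeight_upper hq hr F hb h'
      have h3 := hr.upper hb h'
      rw [zeroWeight_upper hq hr _ hb h']
      simp only [Fin.rev_rev] at h1 ⊢
      rw [h1, h2, h3]
      linear_combination (q⁻¹ * q) ^ 2 * (F b - F a) * hb1 + (q⁻¹ * q + 1) * (F b - F a) * hqq

/-- In rescaled coordinates the constants are the multiples of ∑ x a • (u_a ⊗ u_a'). This makes that
vector an eigenvector of w. -/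
theorem zeroWeight_const (hq : q ≠ 0) (hr : IsRatio q r) (k : K) (a b : Fin N) :
    zeroWeight q r (fun _ => k) a = zeroWeight q r (fun _ => k) b := by
  revert a b
  refine eq_of_forall_succ fun a b hb => ?_
  have ha1 := hr.mul_rev a
  rcases lt_trichotomy b b.rev with h | h | h
  · rw [zeroWeight_lower hq hr _ hb h]; ring
  · rw [zeroWeight_odd_lower hq hr _ hb h]; ring
  · rcases lt_trichotomy a a.rev with h' | h' | h'
    · have hba : b = a.rev := by simp only [Fin.ext_iff, Fin.lt_def, Fin.val_rev] at *; omega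
      rw [zeroWeight_even _ hb hba]
      rw [← hba] at ha1
      rcases hr.even a b hb hba with h2 | h2
      · rw [h2, one_mul] at ha1
        rw [h2, ha1]
        ring
      · have h3 : r b = - q⁻¹ ^ 2 := by
          rw [h2] at ha1
          field_simp
          linear_combination -ha1
        rw [h2, h3]
        field_simp
        ring
    · rw [zeroWeight_odd_upper hq hr _ hb h']; ring
    · rw [zeroWeight_upper hq hr _ hb h']; ring

end Jimbo

/-! ### The weights of types B, C and D -/

namespace Jimbo

variable {K : Type*} [Field K] {N : ℕ}

theorem lt_rev_of_succ {a b : Fin N} (hb : (b : ℕ) = a + 1) (h : b < b.rev) : a < a.rev := by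
  simp only [Fin.lt_def, Fin.val_rev] at *
  omega

theorem rev_lt_of_succ {a b : Fin N} (hb : (b : ℕ) = a + 1) (h : a.rev < a) : b.rev < b := by
  simp only [Fin.lt_def, Fin.val_rev] at *
  omega

/-- Away from the middle the weights grow by q at each step, in all types. The types differ only at
the middle: the factor is 1 in type D and -q² in type C, and in type B the two steps around the
fixed index contribute q together. -/
theorem isRatio_of_steps {q : K} (hq : q ≠ 0) {x : Fin N → K} (hx : ∀ a, x a ≠ 0)
    (step : ∀ a b : Fin N, (b : ℕ) = a + 1 → b < b.rev ∨ a.rev < a → x b = q * x a)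
    (even : ∀ a b : Fin N, (b : ℕ) = a + 1 → b = a.rev → x b = x a ∨ x b = -q ^ 2 * x a)
    (odd : ∀ a b : Fin N, (b : ℕ) = a + 1 → b = b.rev → x a.rev = q * x a) :
    IsRatio q (fun a => x a.rev / x a) where
  self a ha := by rw [← ha, div_self (hx a)]
  mul_rev a := by
    have h1 := hx a
    have h2 := hx a.rev
    rw [Fin.rev_rev]
    field_simp
  lower a b hb h := by
    have h1 := step a b hb (.inl h)
    have h2 := step b.rev a.rev (by simp only [Fin.val_rev]; omega) (.inr (by simpa using h))
    have h3 := hx a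
    rw [h1, h2]
    field_simp
  even a b hb h := by
    rw [← h]
    have h3 := hx a
    rcases even a b hb h with h1 | h1 <;> rw [h1] <;> [left; right] <;> field_simp
  odd a b hb h := by
    have h3 := hx a
    rw [odd a b hb h]
    field_simp

theorem sigma_eps_of_lt (X : ClassicalType) {a : Fin N} (h : a < a.rev) :
    sigma a = 1 ∧ eps X a = 1 := by
  simp only [Fin.lt_def, Fin.val_rev] at h
  rw [sigma, eps, pos, if_pos (by omega), if_pos (by omega)]
  simp

theorem sigma_eps_of_gt (X : ClassicalType) {a : Fin N} (h : a.rev < a) :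
    sigma a = -1 ∧ eps X a = -X.nu := by
  simp only [Fin.lt_def, Fin.val_rev] at h
  rw [sigma, eps, pos, if_neg (by omega), if_neg (by omega), if_neg (by omega)]
  simp

theorem exists_weights_B {q v : K} (hq : q ≠ 0) (hv : v ^ 2 = q) (l : ℕ) :
    ∃ x : Fin (ClassicalType.B.dim l) → K, (∀ a, x a ≠ 0) ∧
      (∀ a d, ((eps .B a * eps .B d : ℤ) : K) * barPow .B q v a d = x a / x d) ∧
      IsRatio q (fun a => x a.rev / x a) := by
  have hv0 : v ≠ 0 := by rintro rfl; simp [eq_comm, hq] at hv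
  have hx : ∀ a : Fin (ClassicalType.B.dim l), v ^ twiceBar .B a ≠ 0 := fun a => zpow_ne_zero _ hv0
  have heps : ∀ a : Fin (ClassicalType.B.dim l), eps .B a = 1 := by
    intro a; simp [eps, ClassicalType.nu]
  refine ⟨fun a => v ^ twiceBar .B a, hx, ?_, isRatio_of_steps hq hx ?_ ?_ ?_⟩
  · intro a d
    simp [heps, barPow, zpow_sub₀ hv0]
  · intro a b hb h
    have h1 : twiceBar .B b = 2 + twiceBar .B a := by
      rcases h with h | h
      · have h' : a < a.rev := lt_rev_of_succ hb h
        simp only [twiceBar, sigma_eps_of_lt .B h, sigma_eps_of_lt .B h', pos]; omega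
      · have h' : b.rev < b := rev_lt_of_succ hb h
        simp only [twiceBar, sigma_eps_of_gt .B h, sigma_eps_of_gt .B h', pos]; omega
    simp only [h1, zpow_add₀ hv0, ← hv]
    norm_cast
  · intro a b hb h
    have h1 := congrArg Fin.val h
    rw [Fin.val_rev] at h1
    have h2 : ClassicalType.B.dim l = 2 * l + 1 := rfl
    omega
  · intro a b hb h
    have h2 : a < a.rev := by simp only [Fin.ext_iff, Fin.lt_def, Fin.val_rev] at *; omega
    have h1 : twiceBar .B a.rev = 2 + twiceBar .B a := by
      have h3 : (a.rev : ℕ) = a + 2 := by simp only [Fin.ext_iff, Fin.val_rev] at *; omega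
      simp only [twiceBar, sigma_eps_of_lt .B h2,
        sigma_eps_of_gt .B (a := a.rev) (by simpa using h2),
        pos, ClassicalType.nu, h3]
      push_cast
      ring
    simp only [h1, zpow_add₀ hv0, ← hv]
    norm_cast

theorem exists_weights_CD {q v : K} (hq : q ≠ 0) (X : ClassicalType) (hX : X = .C ∨ X = .D)
    (l : ℕ) : ∃ x : Fin (X.dim l) → K, (∀ a, x a ≠ 0) ∧
      (∀ a d, ((eps X a * eps X d : ℤ) : K) * barPow X q v a d = x a / x d) ∧
      IsRatio q (fun a => x a.rev / x a) := by
  have hN : X.dim l = 2 * l := by rcases hX with rfl | rfl <;> rfl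
  have hnu : X.nu = 1 ∨ X.nu = -1 := by rcases hX with rfl | rfl <;> simp [ClassicalType.nu]
  have hbar : ∀ a d : Fin (X.dim l), barPow X q v a d =
      q ^ ((twiceBar X a - twiceBar X d) / 2) := by
    rcases hX with rfl | rfl <;> exact fun a d => rfl
  have hcase : ∀ a : Fin (X.dim l), a < a.rev ∨ a.rev < a := by
    intro a; simp only [Fin.lt_def, Fin.val_rev]; omega
  have heps : ∀ a : Fin (X.dim l), ((eps X a : ℤ) : K) = 1 ∨ ((eps X a : ℤ) : K) = -1 := by
    intro a
    rcases hcase a with h | h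
    · simp [sigma_eps_of_lt X h]
    · rcases hnu with h' | h' <;> simp [sigma_eps_of_gt X h, h']
  have hodd : ∀ a : Fin (X.dim l), ∃ k, twiceBar X a = 2 * k - 1 := by
    intro a
    rcases hcase a with h | h <;> rcases hnu with h' | h'
    · exact ⟨pos a, by simp only [twiceBar, sigma_eps_of_lt X h, h']; ring⟩
    · exact ⟨pos a + 1, by simp only [twiceBar, sigma_eps_of_lt X h, h']; ring⟩
    · exact ⟨pos a + 1, by simp only [twiceBar, sigma_eps_of_gt X h, h']; ring⟩
    · exact ⟨pos a, by simp only [twiceBar, sigma_eps_of_gt X h, h']; ring⟩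
  -- `twiceBar` is odd here, so adding 1 makes the halving exact; the shift cancels in ratios.
  have hx : ∀ a : Fin (X.dim l), ((eps X a : ℤ) : K) * q ^ ((twiceBar X a + 1) / 2) ≠ 0 := by
    intro a
    refine mul_ne_zero ?_ (zpow_ne_zero _ hq)
    rcases heps a with h | h <;> simp [h]
  refine ⟨_, hx, ?_, isRatio_of_steps hq hx ?_ ?_ ?_⟩
  · intro a d
    obtain ⟨k, hk⟩ := hodd a
    obtain ⟨m, hm⟩ := hodd d
    have h1 : (twiceBar X a - twiceBar X d) / 2 = k - m := by omega
    have h2 : (twiceBar X a + 1) / 2 = k := by omega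
    have h3 : (twiceBar X d + 1) / 2 = m := by omega
    rw [hbar, h1, h2, h3, zpow_sub₀ hq]
    rcases heps d with h | h <;> simp [h] <;> ring
  · intro a b hb h
    have h1 : (twiceBar X b + 1) / 2 = 1 + (twiceBar X a + 1) / 2 ∧ eps X b = eps X a := by
      rcases h with h | h
      · have h' : a < a.rev := lt_rev_of_succ hb h
        refine ⟨?_, by rw [(sigma_eps_of_lt X h).2, (sigma_eps_of_lt X h').2]⟩
        simp only [twiceBar, sigma_eps_of_lt X h, sigma_eps_of_lt X h', pos, hb]
        push_cast
        omega
      · have h' : b.rev < b := rev_lt_of_succ hb h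
        refine ⟨?_, by rw [(sigma_eps_of_gt X h).2, (sigma_eps_of_gt X h').2]⟩
        simp only [twiceBar, sigma_eps_of_gt X h, sigma_eps_of_gt X h', pos, hb]
        push_cast
        omega
    rw [h1.1, h1.2, zpow_add₀ hq, zpow_one]
    ring
  · intro a b hb h
    have h1 : a < a.rev := by rw [← h, Fin.lt_def]; omega
    have h2 : b.rev < b := by rw [h]; simpa using h1
    rcases hnu with h' | h'
    · have h3 : (twiceBar X b + 1) / 2 = 2 + (twiceBar X a + 1) / 2 := by
        simp only [twiceBar, sigma_eps_of_lt X h1, sigma_eps_of_gt X h2, pos, h']; omega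
      right
      rw [h3, zpow_add₀ hq, (sigma_eps_of_lt X h1).2, (sigma_eps_of_gt X h2).2, h']
      simp
    · have h3 : (twiceBar X b + 1) / 2 = (twiceBar X a + 1) / 2 := by
        simp only [twiceBar, sigma_eps_of_lt X h1, sigma_eps_of_gt X h2, pos, h']; omega
      left
      rw [h3, (sigma_eps_of_lt X h1).2, (sigma_eps_of_gt X h2).2, h']
      simp
  · intro a b hb h
    rcases hcase b with h' | h' <;> rw [← h] at h' <;> exact absurd h' (lt_irrefl b)

/-- The coefficients of Jimbo's matrices of type `B`, `C`, `D` are ratios of weights. -/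
theorem exists_weights {q v : K} (hq : q ≠ 0) (X : ClassicalType) (hX : X ≠ .A)
    (hv : X = .B → v ^ 2 = q) (l : ℕ) : ∃ x : Fin (X.dim l) → K, (∀ a, x a ≠ 0) ∧
      (∀ a d, ((eps X a * eps X d : ℤ) : K) * barPow X q v a d = x a / x d) ∧
      IsRatio q (fun a => x a.rev / x a) := by
  match X, hX, hv with
  | .B, _, hv => exact exists_weights_B hq (hv rfl) l
  | .C, _, _ => exact exists_weights_CD hq .C (.inl rfl) l
  | .D, _, _ => exact exists_weights_CD hq .D (.inr rfl) l

end Jimbo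

/-! ### The coefficients of 1 and w -/

namespace IsBraiding

open FRT

variable {K n : Type*} [Field K] [Fintype n] [DecidableEq n] {w : Matrix (n × n) (n × n) K}
  {Rp Rm : WithConv (FRT w ⊗[K] FRT w →ₗ[K] K)}

/-- The columns `(i, i)`, `(i, j)`, `(j, i)` of `T` are those of `α + β w` for an operator `w` of
Hecke type. -/
structure HeckeColumns (T : Matrix (n × n) (n × n) K) (i j : n) (κ z α β : K) : Prop where
  ii : ∀ x y, T (x, y) (i, i) = if x = i ∧ y = i then α + β * κ else 0
  ij : ∀ x y, T (x, y) (i, j) =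
    (if x = i ∧ y = j then α else 0) + if x = j ∧ y = i then β else 0
  ji : ∀ x y, T (x, y) (j, i) =
    (if x = j ∧ y = i then α - β * z else 0) + if x = i ∧ y = j then β else 0

/-- For T = α + β w with w² = 1 - z w, the two sides of the braid relation differ by α β (α - β z)
(w₁₂ - w₂₃), and one entry detects the scalar. The case β = 0 is excluded by the mixed relation,
which forces κ α² = 0 and so kills a column of the invertible T. -/
theorem hecke_alternative (h : IsBraiding Rp Rm) {i j : n} (hij : i ≠ j) {κ z α β : K}
    (hκ : κ ≠ 0) (hw : HeckeColumns w i j κ z 0 1)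
    (hT : HeckeColumns (formMatrix Rp) i j κ z α β) : β ≠ 0 ∧ (α = 0 ∨ α = β * z) := by
  have hβ : β ≠ 0 := by
    rintro rfl
    have h2 := h.mixed_yangBaxter i i j i i j
    simp [hw.ii, hw.ij, hT.ii, hT.ij, hT.ji, ite_and, hij, hij.symm, hκ] at h2
    have h4 : formMatrix (Braiding.flip Rm) * formMatrix Rp = 1 :=
      mul_eq_one_comm.mp h.formMatrix_mul_flip
    have h3 := congrFun (congrFun h4 (i, j)) (i, j)
    simp [Matrix.mul_apply, hT.ij, h2] at h3
  refine ⟨hβ, ?_⟩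
  have h2 := h.yangBaxter i j i i i j
  simp [hT.ii, hT.ij, hT.ji, ite_and, hij, hij.symm, add_mul, mul_add,
    Finset.sum_add_distrib] at h2
  rcases h2 with h2 | h2 | h2
  · exact absurd h2 hβ
  · exact .inr (sub_eq_zero.mp h2)
  · exact .inl h2

/-- Up to passing to the opposite inverse, the identity does not occur in the matrix of a
braiding of Hecke type. -/
theorem hecke_coeff (h : IsBraiding Rp Rm) {i j : n} (hij : i ≠ j) {κ z α β α' β' : K}
    (hκ : κ ≠ 0) (hw : HeckeColumns w i j κ z 0 1)
    (hT : HeckeColumns (formMatrix Rp) i j κ z α β)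
    (hT' : HeckeColumns (formMatrix (Braiding.flip Rm)) i j κ z α' β') :
    β ≠ 0 ∧ β' ≠ 0 ∧ (α = 0 ∨ α' = 0) := by
  obtain ⟨hβ, hα⟩ := h.hecke_alternative hij hκ hw hT
  refine ⟨hβ, (h.flip.hecke_alternative hij hκ hw hT').1, hα.imp_right fun hα => ?_⟩
  -- When α = β z, the diagonal entry of T at (j, i) vanishes, and this entry of T T⁻¹ = 1 is β α' =
  -- 0.
  have h1 := congrFun (congrFun h.formMatrix_mul_flip (j, i)) (i, j)
  simpa [Matrix.mul_apply, Fintype.sum_prod_type, hT'.ij, hT.ij, hT.ji, ite_and, hij, hij.symm,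
    mul_add, Finset.sum_add_distrib, hα, hβ] using h1

/-- A braiding whose matrix, or that of its opposite inverse, is proportional to `w`. -/
theorem exists_isCanonicalBraiding (h : IsBraiding Rp Rm)
    (hη : ∃ η : K, η ≠ 0 ∧ (formMatrix Rp = η • w ∨ formMatrix (Braiding.flip Rm) = η • w)) :
    ∃ η : K, η ≠ 0 ∧ ∃ Sp Sm : WithConv (FRT w ⊗[K] FRT w →ₗ[K] K),
      IsCanonicalBraiding w η Sp Sm ∧ (Rp = Sp ∨ Rp = Braiding.flip Sm) := by
  obtain ⟨η, hη, h1 | h1⟩ := hη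
  · exact ⟨η, hη, Rp, Rm, h.isCanonicalBraiding h1, .inl rfl⟩
  · exact ⟨η, hη, _, _, h.flip.isCanonicalBraiding h1, .inr (Braiding.flip_flip Rp).symm⟩

end IsBraiding

/-! ### The cubic relation in types B, C and D -/

namespace Jimbo

variable {K : Type*} [Field K] {N : ℕ} {X : ClassicalType} {q v : K} {x : Fin N → K}

/-- Dividing coordinates by the weights absorbs the coefficients x a / x d: the corresponding term
becomes a partial sum depending on a through its range alone, and only the ratios x a' / x a
survive. -/
theorem matBCD_mulVec_rev
    (hc : ∀ a d : Fin N, ((eps X a * eps X d : ℤ) : K) * barPow X q v a d = x a / x d)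
    (hx : ∀ a, x a ≠ 0) (f : Fin N × Fin N → K) (a : Fin N) :
    (matBCD X N q v).mulVec f (a, a.rev) =
      x a * zeroWeight q (fun c => x c.rev / x c) (fun c => f (c, c.rev) / x c) a := by
  simp only [Matrix.mulVec, dotProduct, Fintype.sum_prod_type, matBCD_apply, hc, if_true]
  rw [Finset.sum_comm]
  simp only [add_mul, sub_mul, Finset.sum_add_distrib, Finset.sum_sub_distrib, ite_and, ite_mul,
    zero_mul, Finset.sum_ite_eq', Finset.sum_ite_irrel, Finset.sum_const_zero, Finset.mem_univ,
    if_true]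
  rw [zeroWeight, mul_add, mul_sub]
  have h1 := hx a
  have h2 := hx a.rev
  congr 1
  · congr 1
    · split_ifs <;> simp <;> field_simp
    · split_ifs <;> field_simp
      simp
  · rw [Finset.mul_sum, Finset.mul_sum, ← Finset.sum_filter]
    refine Finset.sum_congr (by ext; simp) fun s _ => ?_
    have h3 := hx s
    have h4 := hx s.rev
    rw [Fin.rev_rev]
    field_simp

theorem matBCD_mulVec_of_ne (f : Fin N × Fin N → K) {a b : Fin N} (h : b ≠ a.rev) :
    (matBCD X N q v).mulVec f (a, b) =
      if a = b then q⁻¹ * f (a, a) else f (b, a) - if b < a then (q - q⁻¹) * f (a, b) else 0 := by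
  simp only [Matrix.mulVec, dotProduct, Fintype.sum_prod_type, matBCD_apply, if_neg h]
  split_ifs
  · simp [ite_and]
  · simp [ite_and, sub_mul]
  · simp [ite_and]

/-- The operator `w ^ 2 + (q - q⁻¹) w - 1`, which is supported on the weight zero subspace. -/
noncomputable def contraction (X : ClassicalType) (N : ℕ) (q v : K) :
    Matrix (Fin N × Fin N) (Fin N × Fin N) K :=
  matBCD X N q v * matBCD X N q v + (q - q⁻¹) • matBCD X N q v - 1

theorem contraction_mulVec (f : Fin N × Fin N → K) :
    (contraction X N q v).mulVec f = (matBCD X N q v).mulVec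
      ((matBCD X N q v).mulVec f + (q - q⁻¹) • f) - f := by
  simp [contraction, Matrix.sub_mulVec, Matrix.add_mulVec, Matrix.mulVec_add, Matrix.mulVec_smul,
    Matrix.smul_mulVec]

/-- Off weight zero, w only mixes (a, b) with (b, a) and satisfies the quadratic relation of type A.
-/
theorem contraction_mulVec_of_ne (hq : q ≠ 0) (f : Fin N × Fin N → K) {a b : Fin N}
    (h : b ≠ a.rev) : (contraction X N q v).mulVec f (a, b) = 0 := by
  have h' : a ≠ b.rev := by rintro rfl; simp at h
  rw [contraction_mulVec, Pi.sub_apply, matBCD_mulVec_of_ne _ h]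
  simp only [Pi.add_apply, Pi.smul_apply, smul_eq_mul]
  by_cases hab : a = b
  · subst hab
    rw [if_pos rfl, matBCD_mulVec_of_ne _ h, if_pos rfl]
    field_simp
    ring
  · rw [if_neg hab, matBCD_mulVec_of_ne _ h, matBCD_mulVec_of_ne _ h', if_neg hab,
      if_neg (Ne.symm hab)]
    rcases lt_or_gt_of_ne hab with h1 | h1
    · simp only [if_pos h1, if_neg h1.not_gt]; ring
    · simp only [if_pos h1, if_neg h1.not_gt]; ring

theorem contraction_mulVec_rev
    (hc : ∀ a d : Fin N, ((eps X a * eps X d : ℤ) : K) * barPow X q v a d = x a / x d)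
    (hx : ∀ a, x a ≠ 0) (f : Fin N × Fin N → K) (a : Fin N) :
    (contraction X N q v).mulVec f (a, a.rev) =
      x a * (zeroWeight q (fun c => x c.rev / x c)
        (fun c => zeroWeight q (fun c => x c.rev / x c) (fun c => f (c, c.rev) / x c) c +
          (q - q⁻¹) * (f (c, c.rev) / x c)) a - f (a, a.rev) / x a) := by
  have h1 : ∀ c, ((matBCD X N q v).mulVec f + (q - q⁻¹) • f) (c, c.rev) / x c =
      zeroWeight q (fun c => x c.rev / x c) (fun c => f (c, c.rev) / x c) c +
          (q - q⁻¹) * (f (c, c.rev) / x c) := by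
    intro c
    have := hx c
    rw [Pi.add_apply, matBCD_mulVec_rev hc hx, Pi.smul_apply, smul_eq_mul]
    field_simp
  rw [contraction_mulVec, Pi.sub_apply, matBCD_mulVec_rev hc hx, mul_sub,
    mul_div_cancel₀ _ (hx a)]
  simp only [h1]

theorem contraction_apply_of_ne (hq : q ≠ 0)
    (hc : ∀ a d : Fin N, ((eps X a * eps X d : ℤ) : K) * barPow X q v a d = x a / x d)
    (hx : ∀ a, x a ≠ 0) (a b : Fin N) {c d : Fin N} (h : d ≠ c.rev) :
    contraction X N q v (a, b) (c, d) = 0 := by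
  have h0 : ∀ e : Fin N, (Pi.single (c, d) 1 : Fin N × Fin N → K) (e, e.rev) = 0 := by
    intro e
    rw [Pi.single_apply, if_neg]
    rintro h1
    simp only [Prod.mk.injEq] at h1
    exact h (h1.1 ▸ h1.2.symm)
  have h1 := congrFun ((contraction X N q v).mulVec_single_one (c, d)) (a, b)
  rw [Matrix.col_apply] at h1
  rw [← h1]
  by_cases hb : b = a.rev
  · rw [hb, contraction_mulVec_rev hc hx]
    simp only [h0, zero_div]
    simp [zeroWeight]
  · exact contraction_mulVec_of_ne hq _ hb

/-- By `zeroWeight_quadratic` the image of the contraction lies in the line of ∑ x a • (u_a ⊗ u_a'),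
on which w is a scalar by `zeroWeight_const`. This is the cubic relation for w. -/
theorem exists_matBCD_mul_contraction (hq : q ≠ 0)
    (hc : ∀ a d : Fin N, ((eps X a * eps X d : ℤ) : K) * barPow X q v a d = x a / x d)
    (hx : ∀ a, x a ≠ 0) (hr : IsRatio q (fun a => x a.rev / x a)) :
    ∃ μ : K, matBCD X N q v * contraction X N q v = μ • contraction X N q v := by
  rcases N.eq_zero_or_pos with rfl | hN
  · exact ⟨0, by ext ⟨a, b⟩; exact a.elim0⟩
  refine ⟨zeroWeight q (fun c => x c.rev / x c) (fun _ => 1) ⟨0, hN⟩, ?_⟩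
  refine Matrix.ext_of_mulVec_single fun p => ?_
  generalize (Pi.single p 1 : Fin N × Fin N → K) = f
  rw [← Matrix.mulVec_mulVec, Matrix.smul_mulVec]
  ext ⟨a, b⟩
  rw [Pi.smul_apply, smul_eq_mul]
  by_cases hb : b = a.rev
  · have h1 : ∀ c, (contraction X N q v).mulVec f (c, c.rev) / x c =
        (contraction X N q v).mulVec f (a, a.rev) / x a := by
      intro c
      rw [contraction_mulVec_rev hc hx, contraction_mulVec_rev hc hx, mul_div_cancel_left₀ _ (hx c),
        mul_div_cancel_left₀ _ (hx a)]
      exact zeroWeight_quadratic hq hr _ c a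
    rw [hb, matBCD_mulVec_rev hc hx]
    simp only [h1]
    rw [zeroWeight_const hq hr 1 ⟨0, hN⟩ a]
    have := hx a
    have h2 : ∀ k : K, zeroWeight q (fun c => x c.rev / x c) (fun _ => k) a =
        k * zeroWeight q (fun c => x c.rev / x c) (fun _ => 1) a := by
      intro k
      simp only [zeroWeight, mul_one, ← Finset.sum_mul]
      split_ifs <;> ring
    rw [h2]
    field_simp
  · have hb' : a ≠ b.rev := by rintro rfl; simp at hb
    rw [matBCD_mulVec_of_ne _ hb, contraction_mulVec_of_ne hq _ hb,
      contraction_mulVec_of_ne hq _ hb']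
    split_ifs with h1
    · subst h1; rw [contraction_mulVec_of_ne hq _ hb]; simp
    all_goals simp

end Jimbo

/-! ### Braidings in type A and in types B, C, D -/

namespace Jimbo

open FRT IsBraiding

variable {K : Type*} [Field K] {N : ℕ}

theorem matA_mulVec (q : K) (f : Fin N × Fin N → K) (a b : Fin N) :
    (matA N q).mulVec f (a, b) =
      if a = b then q⁻¹ * f (a, a) else f (b, a) - if b < a then (q - q⁻¹) * f (a, b) else 0 := by
  simp only [Matrix.mulVec, dotProduct, Fintype.sum_prod_type, matA_apply]
  split_ifs
  · simp [ite_and]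
  · simp [ite_and, sub_mul]
  · simp [ite_and]

theorem matA_mul_self {q : K} (hq : q ≠ 0) :
    matA N q * matA N q = (1 : K) • 1 + (-(q - q⁻¹)) • matA N q := by
  refine Matrix.ext_of_mulVec_single fun p => ?_
  generalize (Pi.single p 1 : Fin N × Fin N → K) = f
  rw [← Matrix.mulVec_mulVec, Matrix.add_mulVec, Matrix.smul_mulVec, Matrix.smul_mulVec,
    Matrix.one_mulVec]
  ext ⟨a, b⟩
  simp only [Pi.add_apply, Pi.smul_apply, smul_eq_mul, matA_mulVec]
  rcases lt_trichotomy a b with h | h | h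
  · simp only [h, h.ne, h.ne', h.not_gt, if_true, if_false]; ring
  · subst h
    simp only [if_true]
    field_simp
    ring
  · simp only [h, h.ne, h.ne', h.not_gt, if_true, if_false]; ring

theorem heckeColumns_matA (q α β : K) {i j : Fin N} (hij : i < j) :
    HeckeColumns (α • 1 + β • matA N q) i j q⁻¹ (q - q⁻¹) α β := by
  constructor <;> intro x y <;>
    simp only [Matrix.add_apply, Matrix.smul_apply, Matrix.one_apply, matA_apply, smul_eq_mul,
      Prod.mk.injEq] <;> grind

/-- For i < j, w sends u_i ⊗ u_j to u_j ⊗ u_i, so these two vectors serve as e and u in the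
bicommutant criterion. -/
theorem exists_formMatrix_matA {q : K} (hq : q ≠ 0) {i j : Fin N} (hij : i < j)
    {Rp Rm : WithConv (FRT (matA N q) ⊗[K] FRT (matA N q) →ₗ[K] K)} (h : IsBraiding Rp Rm) :
    ∃ α β : K, formMatrix Rp = α • 1 + β • matA N q := by
  refine Matrix.exists_of_mem_bicommutant_quadratic (fun M hM => h.formMatrix_commute hM)
    (matA_mul_self hq) (e := Pi.single (i, j) 1) (u := Pi.single (j, i) 1) ?_ ?_
  · simp [hij.ne']
  · simp [matA_apply, hij.ne']

theorem exists_canonical_matA {q : K} (hq : q ≠ 0) {i j : Fin N} (hij : i < j)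
    {Rp Rm : WithConv (FRT (matA N q) ⊗[K] FRT (matA N q) →ₗ[K] K)} (h : IsBraiding Rp Rm) :
    ∃ η : K, η ≠ 0 ∧
      (formMatrix Rp = η • matA N q ∨ formMatrix (Braiding.flip Rm) = η • matA N q) := by
  obtain ⟨α, β, hT⟩ := exists_formMatrix_matA hq hij h
  obtain ⟨α', β', hT'⟩ := exists_formMatrix_matA hq hij h.flip
  obtain ⟨hβ, hβ', h0⟩ := h.hecke_coeff hij.ne (inv_ne_zero hq)
    (by simpa using heckeColumns_matA q 0 1 hij) (hT ▸ heckeColumns_matA q α β hij)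
    (hT' ▸ heckeColumns_matA q α' β' hij)
  rcases h0 with rfl | rfl
  · exact ⟨β, hβ, .inl (by simpa using hT)⟩
  · exact ⟨β', hβ', .inr (by simpa using hT')⟩

variable {X : ClassicalType} {q v : K} {x : Fin N → K}

/-- With i and j below the middle, none of the three columns has weight zero: the contraction
vanishes there and w acts as in type A. -/
theorem heckeColumns_matBCD (hq : q ≠ 0)
    (hc : ∀ a d : Fin N, ((eps X a * eps X d : ℤ) : K) * barPow X q v a d = x a / x d)
    (hx : ∀ a, x a ≠ 0) (α β γ : K) {i j : Fin N} (hij : i < j) (hj : j < j.rev) :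
    HeckeColumns (α • 1 + β • matBCD X N q v + γ • contraction X N q v) i j q⁻¹ (q - q⁻¹) α β := by
  have h1 : i < i.rev := hij.trans (hj.trans (Fin.rev_lt_rev.mpr hij))
  have h2 : i < j.rev := hij.trans hj
  have h3 : j < i.rev := hj.trans (Fin.rev_lt_rev.mpr hij)
  constructor <;> intro a b <;>
    simp only [Matrix.add_apply, Matrix.smul_apply, Matrix.one_apply, smul_eq_mul, matBCD_apply,
      Prod.mk.injEq, contraction_apply_of_ne hq hc hx a b h1.ne,
      contraction_apply_of_ne hq hc hx a b h2.ne, contraction_apply_of_ne hq hc hx a b h3.ne] <;>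
    grind

theorem matBCD_apply_rev_of_ne {a b : Fin N} (h : b ≠ a.rev) (c : Fin N) :
    matBCD X N q v (a, b) (c, c.rev) = 0 := by
  rw [matBCD_apply]
  have := Fin.rev_rev a
  have := Fin.rev_rev b
  have := Fin.rev_rev c
  grind

theorem contraction_apply_rev_of_ne (hq : q ≠ 0) {a b : Fin N} (h : b ≠ a.rev) (c : Fin N) :
    contraction X N q v (a, b) (c, c.rev) = 0 := by
  have h1 := contraction_mulVec_of_ne (X := X) (v := v) hq (Pi.single (c, c.rev) 1) h
  rwa [Matrix.mulVec_single_one, Matrix.col_apply] at h1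

theorem matBCD_mulVec_single_first {i : Fin N} (hi : ∀ a : Fin N, i ≤ a) (hi' : i < i.rev) :
    (matBCD X N q v).mulVec (Pi.single (i, i.rev) 1) = q • Pi.single (i.rev, i) 1 := by
  rw [Matrix.mulVec_single_one]
  ext ⟨a, b⟩
  have h1 : a ≤ i.rev := by simpa using Fin.rev_le_rev.mpr (hi a.rev)
  have h2 := hi b
  have h3 := Fin.rev_rev a
  have h4 : ¬ i.rev < a := h1.not_gt
  rw [Matrix.col_apply, matBCD_apply, Pi.smul_apply, Pi.single_apply, smul_eq_mul]
  simp only [if_neg h4, Prod.mk.injEq]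
  grind

theorem contraction_first {i : Fin N} (hi : ∀ a : Fin N, i ≤ a) (hi' : i < i.rev) :
    contraction X N q v (i, i.rev) (i, i.rev) = q ^ 2 - 1 := by
  have h1 : (contraction X N q v).mulVec (Pi.single (i, i.rev) 1) (i, i.rev) =
      contraction X N q v (i, i.rev) (i, i.rev) := by
    rw [Matrix.mulVec_single_one, Matrix.col_apply]
  rw [← h1, contraction_mulVec, matBCD_mulVec_single_first hi hi', Matrix.mulVec_add,
    Matrix.mulVec_smul, Matrix.mulVec_smul, matBCD_mulVec_single_first hi hi',
    Matrix.mulVec_single_one]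
  simp only [Pi.sub_apply, Pi.add_apply, Pi.smul_apply, Matrix.col_apply, smul_eq_mul,
    matBCD_apply, Pi.single_apply, Prod.mk.injEq]
  simp [hi'.ne, hi'.ne', hi'.not_gt]
  ring

theorem exists_formMatrix_matBCD (hq : q ≠ 0) (hq2 : q ^ 2 ≠ 1)
    (hc : ∀ a d : Fin N, ((eps X a * eps X d : ℤ) : K) * barPow X q v a d = x a / x d)
    (hx : ∀ a, x a ≠ 0) (hr : IsRatio q (fun a => x a.rev / x a)) {i j : Fin N}
    (hi : ∀ a : Fin N, i ≤ a) (hij : i < j) (hj : j < j.rev)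
    {Rp Rm : WithConv (FRT (matBCD X N q v) ⊗[K] FRT (matBCD X N q v) →ₗ[K] K)}
    (h : IsBraiding Rp Rm) :
    ∃ α β γ : K, formMatrix Rp = α • 1 + β • matBCD X N q v + γ • contraction X N q v := by
  obtain ⟨μ, hμ⟩ := exists_matBCD_mul_contraction hq hc hx hr
  have hi' : i < i.rev := hij.trans (hj.trans (Fin.rev_lt_rev.mpr hij))
  have hz : q - q⁻¹ ≠ 0 := by
    intro h0
    apply hq2
    field_simp at h0
    linear_combination h0
  have hw : matBCD X N q v * (matBCD X N q v * matBCD X N q v) =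
      (-μ) • 1 + (1 + μ * (q - q⁻¹)) • matBCD X N q v +
        (μ - (q - q⁻¹)) • (matBCD X N q v * matBCD X N q v) := by
    rw [contraction, mul_sub, mul_add, mul_one, mul_smul_comm] at hμ
    rw [← sub_eq_zero] at hμ ⊢
    rw [← hμ]
    module
  have hk : q * ((q - q⁻¹) * (x j / x i)) ≠ 0 :=
    mul_ne_zero hq (mul_ne_zero hz (div_ne_zero (hx j) (hx i)))
  -- For the first index i, w maps e = u_i ⊗ u_i' to q u_i' ⊗ u_i. The coordinate at (j, j')
  -- vanishes on e and w e, but on w² e it is q (q - q⁻¹) x j / x i, whose inverse normalizes u.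
  obtain ⟨a, b, c, hT⟩ := Matrix.exists_of_mem_bicommutant_cubic
    (fun M hM => h.formMatrix_commute hM) hw (e := Pi.single (i, i.rev) 1)
    (u := Pi.single (j, j.rev) (q * ((q - q⁻¹) * (x j / x i)))⁻¹)
    (by simp [hij.ne'])
    (by
      rw [matBCD_mulVec_single_first hi hi']
      have : j ≠ i.rev := (hj.trans (Fin.rev_lt_rev.mpr hij)).ne
      simp [this])
    (by
      rw [matBCD_mulVec_single_first hi hi', Matrix.mulVec_smul, Matrix.mulVec_single_one]
      have h1 : j ≠ i.rev := (hj.trans (Fin.rev_lt_rev.mpr hij)).ne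
      have h2 : matBCD X N q v (j, j.rev) (i.rev, i) = (q - q⁻¹) * (x j / x i) := by
        rw [matBCD_apply, hc]
        simp [hij, hij.ne, h1.symm]
      rw [single_dotProduct, Pi.smul_apply, Matrix.col_apply, h2, smul_eq_mul]
      exact inv_mul_cancel₀ hk)
  refine ⟨a + c, b - c * (q - q⁻¹), c, ?_⟩
  rw [hT, contraction]
  module

theorem coeff_contraction_eq_zero (hq : q ≠ 0) (hq2 : q ^ 2 ≠ 1)
    (hc : ∀ a d : Fin N, ((eps X a * eps X d : ℤ) : K) * barPow X q v a d = x a / x d)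
    (hx : ∀ a, x a ≠ 0) {i j : Fin N}
    (hi : ∀ a : Fin N, i ≤ a) (hij : i < j) (hj : j < j.rev)
    {Rp Rm : WithConv (FRT (matBCD X N q v) ⊗[K] FRT (matBCD X N q v) →ₗ[K] K)}
    (h : IsBraiding Rp Rm) {β γ : K} (hβ : β ≠ 0)
    (hT : formMatrix Rp = β • matBCD X N q v + γ • contraction X N q v) : γ = 0 := by
  have hi' : i < i.rev := hij.trans (hj.trans (Fin.rev_lt_rev.mpr hij))
  have hji : j < i.rev := hj.trans (Fin.rev_lt_rev.mpr hij)
  have hz : q - q⁻¹ ≠ 0 := by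
    intro h0
    apply hq2
    field_simp at h0
    linear_combination h0
  have T1 : ∀ a b, formMatrix Rp (a, b) (i, j) = if a = j ∧ b = i then β else 0 := by
    intro a b
    have := (heckeColumns_matBCD hq hc hx 0 β γ hij hj).ij a b
    rw [hT]
    simpa using this
  have T2 : ∀ a b c : Fin N, b ≠ a.rev → formMatrix Rp (a, b) (c, c.rev) = 0 := by
    intro a b c hb
    simp [hT, matBCD_apply_rev_of_ne hb, contraction_apply_rev_of_ne hq hb]
  have w1 : ∀ a b, matBCD X N q v (a, b) (j, i.rev) = if a = i.rev ∧ b = j then 1 else 0 := by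
    intro a b
    rw [matBCD_apply]
    have := Fin.rev_rev a
    grind
  have T3 : formMatrix Rp (i.rev, j) (i.rev, j) = -(β * (q - q⁻¹)) := by
    have h1 : j ≠ i.rev.rev := by rw [Fin.rev_rev]; exact hij.ne'
    rw [hT, Matrix.add_apply, Matrix.smul_apply, Matrix.smul_apply,
      contraction_apply_of_ne hq hc hx _ _ h1, matBCD_apply]
    simp [hij.ne', hji, hji.ne, hji.ne']
    ring
  have T4 : formMatrix Rp (i, i.rev) (i, i.rev) = γ * (q ^ 2 - 1) := by
    rw [hT, Matrix.add_apply, Matrix.smul_apply, Matrix.smul_apply, contraction_first hi hi',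
      matBCD_apply]
    simp [hi'.ne, hi'.ne', hi'.not_gt]
  have w2 : matBCD X N q v (i, i.rev) (j, j.rev) = 0 := by
    rw [matBCD_apply]
    have h2 : ¬ j.rev < i := (hi _).not_gt
    simp [hji.ne, hi'.not_gt, h2]
  -- On the left, T₁₂ turns (i, j) into (j, i); T₂₃ then needs d = j', where the entry `w2` of w is
  -- zero. On the right a single path survives, with value -β (q - q⁻¹) γ (q² - 1).
  have h1 := h.mixed_yangBaxter i i.rev j i j i.rev
  have hl : ∑ c, ∑ d, matBCD X N q v (i, i.rev) (c, d) *
      ∑ k, formMatrix Rp (d, j) (k, i.rev) * formMatrix Rp (c, k) (i, j) = 0 := by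
    refine Finset.sum_eq_zero fun c _ => Finset.sum_eq_zero fun d _ => ?_
    by_cases hcj : c = j
    · by_cases hd : d = j.rev
      · rw [hcj, hd, w2, zero_mul]
      · have hd' : j ≠ d.rev := by rintro rfl; simp at hd
        simp [T1, T2 d j i hd', hcj]
    · simp [T1, hcj]
  have hrr : ∑ k, formMatrix Rp (i.rev, j) (k, j) * formMatrix Rp (i, k) (i, i.rev) =
      -(β * (q - q⁻¹)) * (γ * (q ^ 2 - 1)) := by
    rw [Fintype.sum_eq_single i.rev, T3, T4]
    intro k hk
    rw [T2 i k i hk, mul_zero]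
  rw [hl] at h1
  simp only [w1, ite_and, ite_mul, zero_mul, one_mul, Finset.sum_ite_eq', Finset.sum_ite_irrel,
    Finset.sum_const_zero, Finset.mem_univ, if_true] at h1
  rw [hrr] at h1
  have h2 : q ^ 2 - 1 ≠ 0 := sub_ne_zero.mpr hq2
  simpa [hβ, hz, h2] using h1.symm

theorem exists_canonical_matBCD (hq : q ≠ 0) (hq2 : q ^ 2 ≠ 1)
    (hc : ∀ a d : Fin N, ((eps X a * eps X d : ℤ) : K) * barPow X q v a d = x a / x d)
    (hx : ∀ a, x a ≠ 0) (hr : IsRatio q (fun a => x a.rev / x a)) {i j : Fin N}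
    (hi : ∀ a : Fin N, i ≤ a) (hij : i < j) (hj : j < j.rev)
    {Rp Rm : WithConv (FRT (matBCD X N q v) ⊗[K] FRT (matBCD X N q v) →ₗ[K] K)}
    (h : IsBraiding Rp Rm) :
    ∃ η : K, η ≠ 0 ∧ (formMatrix Rp = η • matBCD X N q v ∨
      formMatrix (Braiding.flip Rm) = η • matBCD X N q v) := by
  obtain ⟨α, β, γ, hT⟩ := exists_formMatrix_matBCD hq hq2 hc hx hr hi hij hj h
  obtain ⟨α', β', γ', hT'⟩ := exists_formMatrix_matBCD hq hq2 hc hx hr hi hij hj h.flip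
  obtain ⟨hβ, hβ', h0⟩ := h.hecke_coeff hij.ne (inv_ne_zero hq)
    (by simpa using heckeColumns_matBCD hq hc hx 0 1 0 hij hj)
    (hT ▸ heckeColumns_matBCD hq hc hx α β γ hij hj)
    (hT' ▸ heckeColumns_matBCD hq hc hx α' β' γ' hij hj)
  rcases h0 with rfl | rfl
  · rw [zero_smul, zero_add] at hT
    rw [coeff_contraction_eq_zero hq hq2 hc hx hi hij hj h hβ hT, zero_smul, add_zero] at hT
    exact ⟨β, hβ, .inl hT⟩
  · rw [zero_smul, zero_add] at hT'
    rw [coeff_contraction_eq_zero hq hq2 hc hx hi hij hj h.flip hβ' hT', zero_smul,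
      add_zero] at hT'
    exact ⟨β', hβ', .inr hT'⟩

theorem exists_canonical_mat_of_ne (hq : q ≠ 0) (hq2 : q ^ 2 ≠ 1) (hX : X ≠ .A)
    (hv : X = .B → v ^ 2 = q) {l : ℕ} (hl : 2 ≤ l)
    {Rp Rm : WithConv (FRT (matBCD X (X.dim l) q v) ⊗[K] FRT (matBCD X (X.dim l) q v) →ₗ[K] K)}
    (h : IsBraiding Rp Rm) :
    ∃ η : K, η ≠ 0 ∧ (formMatrix Rp = η • matBCD X (X.dim l) q v ∨
      formMatrix (Braiding.flip Rm) = η • matBCD X (X.dim l) q v) := by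
  obtain ⟨x, hx, hc, hr⟩ := exists_weights hq X hX hv l
  -- Dimension at least 4 is what puts two indices, the first and the second, strictly below the
  -- middle.
  have hN : 4 ≤ X.dim l := by
    match X, hX with
    | .B, _ => simp only [ClassicalType.dim]; omega
    | .C, _ => simp only [ClassicalType.dim]; omega
    | .D, _ => simp only [ClassicalType.dim]; omega
  refine exists_canonical_matBCD (i := ⟨0, by omega⟩) (j := ⟨1, by omega⟩) hq hq2 hc hx hr
    (fun a => Fin.le_def.mpr (Nat.zero_le _)) (Fin.lt_def.mpr one_pos) ?_ h
  rw [Fin.lt_def, Fin.val_rev]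
  simp only
  omega

end Jimbo

theorem mainTheorem7 {K : Type*} [Field K] (X : ClassicalType) (l : ℕ) (hl : X.minRank ≤ l)
    (q v : K) (hq : q ≠ 0) (hq2 : q ^ 2 ≠ 1) (hv : X = ClassicalType.B → v ^ 2 = q)
    (Rp Rm : WithConv (FRT (Jimbo.mat X l q v) ⊗[K] FRT (Jimbo.mat X l q v) →ₗ[K] K))
    (hR : IsBraiding Rp Rm) :
    ∃ η : K, η ≠ 0 ∧ ∃ Sp Sm : WithConv
        (FRT (Jimbo.mat X l q v) ⊗[K] FRT (Jimbo.mat X l q v) →ₗ[K] K),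
      IsCanonicalBraiding (Jimbo.mat X l q v) η Sp Sm ∧
        (Rp = Sp ∨ Rp = Braiding.flip Sm) := by
  refine hR.exists_isCanonicalBraiding ?_
  match X, hl, hv with
  | .A, hl, _ =>
    have hl' : 1 ≤ l := hl
    exact Jimbo.exists_canonical_matA (N := l + 1) hq (i := ⟨0, by omega⟩) (j := ⟨1, by omega⟩)
      (Fin.lt_def.mpr one_pos) hR
  | .B, hl, hv => exact Jimbo.exists_canonical_mat_of_ne (X := .B) hq hq2 (by simp) hv hl hR
  | .C, hl, hv => exact Jimbo.exists_canonical_mat_of_ne (X := .C) hq hq2 (by simp) hv hl hR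
  | .D, hl, hv => exact Jimbo.exists_canonical_mat_of_ne (X := .D) hq hq2 (by simp) hv hl hR
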